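/- Let $n\ge 2$ and let $\Sigma\subset\mathbb R^n$ be a compact connected embedded hypersurface of class $C^2$ enclosing a bounded domain $\Omega$, i.e. $\Omega$ is open, connected and bounded with $\partial\Omega=\Sigma$. (Embedded of class $C^k$ means: every $p\in\Sigma$ has an open neighbourhood $V$ in $\mathbb R^n$ and a $C^k$-diffeomorphism $\Phi$ of $V$ onto an open subset $U$ of $\mathbb R^{n-1}\times\mathbb R$ with $\Phi(V\cap\Sigma)=U\cap(\mathbb R^{n-1}\times\{0\})$; real analytic hypersurfaces are defined in the same way, with $\Phi$ and $\Phi^{-1}$ real analytic.) Then for every $\varepsilon>0$ there are a compact connected real analytic embedded hypersurface $\Sigma_\varepsilon\subset\mathbb R^n$ enclosing a bounded domain, with outer unit normal $\nu_{\Sigma_\varepsilon}$, and a function $\rho_\varepsilon\in C^2(\Sigma_\varepsilon)$ such that $\Sigma$ is a $C^2$-graph over $\Sigma_\varepsilon$ in normal direction, i.e. the map $p\mapsto p+\rho_\varepsilon(p)\nu_{\Sigma_\varepsilon}(p)$ is injective on $\Sigma_\varepsilon$ and $$\Sigma=\{p+\rho_\varepsilon(p)\nu_{\Sigma_\varepsilon}(p):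 p\in\Sigma_\varepsilon\},$$ and $$|\rho_\varepsilon|_\infty+|\nabla_{\Sigma_\varepsilon}\rho_\varepsilon|_\infty+|\nabla^2_{\Sigma_\varepsilon}\rho_\varepsilon|_\infty\le\varepsilon .$$ Here $|\cdot|_\infty$ is the supremum norm over $\Sigma_\varepsilon$ (Euclidean norm for vectors, operator norm for operators). For a local parametrization with tangent vectors $\tau_i$ and dual tangent vectors $\tau^i$, the surface gradient of a scalar function is $\nabla_{\Sigma_\varepsilon}\rho=\sum_i(\partial_i\rho)\,\tau^i$, and $\nabla^2_{\Sigma_\varepsilon}\rho=\sum_i\tau^i\otimes\partial_i(\nabla_{\Sigma_\varepsilon}\rho)$ is the surface gradient of the $\mathbb R^n$-valued field $\nabla_{\Sigma_\varepsilon}\rho$, where $(a\otimes b)x=(b|x)a$. -/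

import Mathlib

open scoped ContDiff InnerProductSpace ENNReal

noncomputable section

namespace HypersurfaceApprox

/-- The Euclidean space `ℝⁿ` with `n = m + 1`; hypersurfaces in it have dimension `m`. -/
abbrev Amb (m : ℕ) : Type := EuclideanSpace ℝ (Fin (m + 1))

/-- The parameter space `ℝⁿ⁻¹` of a hypersurface. -/
abbrev Par (m : ℕ) : Type := EuclideanSpace ℝ (Fin m)

/-- `Φ` is a chart of class `C^k` that flattens `S`: a diffeomorphism of class `C^k` between an
open subset of `ℝⁿ` and an open subset of `ℝⁿ⁻¹ × ℝ` which carries the part of `S` in its domain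
onto the part of `ℝⁿ⁻¹ × {0}` in its range. The exponent `k = ω` means real analytic. -/
structure IsFlatteningChart {m : ℕ} (k : WithTop ℕ∞) (S : Set (Amb m))
    (Φ : OpenPartialHomeomorph (Amb m) (Par m × ℝ)) : Prop where
  contDiffOn : ContDiffOn ℝ k Φ Φ.source
  contDiffOn_symm : ContDiffOn ℝ k Φ.symm Φ.target
  mem_iff : ∀ x ∈ Φ.source, x ∈ S ↔ (Φ x).2 = 0

/-- `S` is an embedded hypersurface of class `C^k` (without boundary) in `ℝⁿ`. -/
def IsHypersurface {m : ℕ} (k : WithTop ℕ∞) (S : Set (Amb m)) : Prop :=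
  ∀ p ∈ S, ∃ Φ : OpenPartialHomeomorph (Amb m) (Par m × ℝ),
    p ∈ Φ.source ∧ IsFlatteningChart k S Φ

/-- `S` is a compact connected embedded hypersurface of class `C^k` in `ℝⁿ` that encloses the
bounded domain `Ω`. -/
structure IsEnclosingHypersurface {m : ℕ} (k : WithTop ℕ∞) (S Ω : Set (Amb m)) : Prop where
  isHypersurface : IsHypersurface k S
  isCompact : IsCompact S
  isConnected : IsConnected S
  isOpen_domain : IsOpen Ω
  isConnected_domain : IsConnected Ω
  isBounded_domain : Bornology.IsBounded Ω
  frontier_domain : frontier Ω = S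

/-- `v` is the outer unit normal at `p ∈ S` of a hypersurface `S` enclosing `Ω`: a unit vector
orthogonal to the tangent space of `S` at `p` that points out of `Ω`. (For a hypersurface, the
tangent cone at `p` is the tangent space at `p`.) -/
structure IsOuterUnitNormalAt {m : ℕ} (S Ω : Set (Amb m)) (p v : Amb m) : Prop where
  norm_eq_one : ‖v‖ = 1
  orthogonal : ∀ w ∈ tangentConeAt ℝ S p, ⟪w, v⟫_ℝ = 0
  inside : ∀ᶠ t : ℝ in nhdsWithin 0 (Set.Ioi 0), p - t • v ∈ Ω
  outside : ∀ᶠ t : ℝ in nhdsWithin 0 (Set.Ioi 0), p + t • v ∉ closure Ω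

/-- `ρ` is of class `C^k` on the hypersurface `S`: its expression `θ ↦ ρ (φ θ)` is of class `C^k`
for each local parametrization `φ θ = Φ⁻¹ (θ, 0)` of class `C^k`. Only the values of `ρ` on `S`
matter. -/
def IsOfClassOn {m : ℕ} (k : WithTop ℕ∞) (S : Set (Amb m)) (ρ : Amb m → ℝ) : Prop :=
  ∀ Φ : OpenPartialHomeomorph (Amb m) (Par m × ℝ), IsFlatteningChart k S Φ →
    ContDiffOn ℝ k (fun θ : Par m => ρ (Φ.symm (θ, 0))) {θ : Par m | (θ, (0 : ℝ)) ∈ Φ.target}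

/-- The projection `I - v ⊗ v`; for a unit normal `v` of `S` at `p`, this is the orthogonal
projection of `ℝⁿ` onto the tangent space of `S` at `p`. -/
def tangentProj {m : ℕ} (v : Amb m) : Amb m →L[ℝ] Amb m :=
  ContinuousLinearMap.id ℝ (Amb m) - (innerSL ℝ v).smulRight v

/-- The derivative along `S`, with unit normal field `ν`, of `f : S → F`, extended by zero in the
normal direction: in a local parametrization with tangent vectors `τ_i` and dual vectors `τ^i` it
is the map `x ↦ ∑ i, (τ^i | x) ∂_i f`. Any two derivatives of `f` within `S` agree on the tangent
space, so composing with the projection onto it gives a well-defined map; it depends only on the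
values of `f` on `S`. -/
def surfaceDeriv {m : ℕ} {F : Type*} [NormedAddCommGroup F] [NormedSpace ℝ F]
    (S : Set (Amb m)) (ν : Amb m → Amb m) (f : Amb m → F) (p : Amb m) : Amb m →L[ℝ] F :=
  (fderivWithin ℝ f S p) ∘L tangentProj (ν p)

/-- The surface gradient `∇_S ρ = ∑ i, (∂_i ρ) τ^i` of a scalar field. -/
def surfaceGrad {m : ℕ} (S : Set (Amb m)) (ν : Amb m → Amb m) (ρ : Amb m → ℝ) (p : Amb m) :
    Amb m :=
  (InnerProductSpace.toDual ℝ (Amb m)).symm (surfaceDeriv S ν ρ p)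

/-- The second surface gradient `∇_S² ρ = ∇_S (∇_S ρ) = ∑ i, τ^i ⊗ ∂_i (∇_S ρ)`, an operator on
`ℝⁿ`, where `(a ⊗ b) x = (b | x) a`. -/
def surfaceGrad2 {m : ℕ} (S : Set (Amb m)) (ν : Amb m → Amb m) (ρ : Amb m → ℝ) (p : Amb m) :
    Amb m →L[ℝ] Amb m :=
  ContinuousLinearMap.adjoint (surfaceDeriv S ν (surfaceGrad S ν ρ) p)

/-- The supremum norm over `S`, with values in `[0, ∞]`. -/
def supNorm {m : ℕ} {F : Type*} [NormedAddCommGroup F] (S : Set (Amb m)) (f : Amb m → F) : ℝ≥0∞ :=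
  ⨆ p ∈ S, ‖f p‖ₑ

end HypersurfaceApprox

end

noncomputable section

open MeasureTheory Filter Topology Set

set_option maxSynthPendingDepth 3

namespace HypersurfaceApprox

/-! ### Gaussian mollification with control of one extra derivative. -/

section Mollification

/-! The surface `S` is the zero set of a C² function `g` that is negative exactly on `Ω`, regular on
`S`, and constant 1 far away (`IsEnclosingHypersurface.exists_defining_function`). Convolving `g -
1` with a narrow Gaussian and adding 1 gives an analytic `h` that is C²-close to `g`. The new
surface is `{h = 0}` with normal `ν = ∇h / |∇h|`. The graph function `ρ` solves `g (p + ρ p • ν p) =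
h p`, not only on `{h = 0}` but on a whole neighbourhood of `S`, so it can be estimated by ambient
derivatives.

The obstacle is a loss of one derivative: `D²ρ` contains `ρ D²ν`, and `D²ν` contains `D³h`, which C²
bounds on `g` do not control. The way out is a balance of rates (`exists_analytic_approx`). At scale
`δ` the mollification moves `g` by `O(δ)`, because `g` is Lipschitz, while `D³h` is `o(1/δ)`,
because `D²g` is uniformly continuous. Thus `|h - g| · |D³h|` tends to 0. Since `|ρ|` is bounded by
a multiple of `|h - g|`, the dangerous term is small (`exists_graph_function`).

The rest is topology. The displacement `ρ • ν` is small with derivative at most 1/2, so `p ↦ p + ρ p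
• ν p` is injective on `{h = 0}` (`injOn_add_of_small`) and reaches every point of `S` by a fixed
point argument (`exists_add_eq_of_small`). Hence `{h = 0}` is homeomorphic to `S` and connected.
That `{h < 0}` is connected follows by pushing points along one gradient step
(`isConnected_sublevel`). Finally `surfaceDeriv_eq` reduces surface derivatives to tangential parts
of ambient ones. -/

lemma exists_norm_sub_le_add_mul {E F : Type*} [NormedAddCommGroup E]
    [NormedAddCommGroup F] {W : E → F} (hW : Continuous W) (hc : HasCompactSupport W)
    {a : ℝ} (ha : 0 < a) : ∃ C, 0 ≤ C ∧ ∀ x w, ‖W (x - w) - W x‖ ≤ a + C * ‖w‖ := by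
  obtain ⟨M, hM⟩ := hW.bounded_above_of_compact_support hc
  have hM0 : 0 ≤ M := (norm_nonneg _).trans (hM 0)
  obtain ⟨r, hr, h⟩ := Metric.uniformContinuous_iff.1 (hc.uniformContinuous_of_continuous hW) a ha
  -- Below distance `r` uniform continuity gives `a`; beyond it the trivial bound `2 * M` is at most
  -- `2 * M / r * ‖w‖`.
  refine ⟨2 * M / r, by positivity, fun x w => ?_⟩
  by_cases hw : ‖w‖ < r
  · have := h (a := x - w) (b := x) (by simpa [dist_eq_norm] using hw)
    rw [dist_eq_norm] at this
    have : 0 ≤ 2 * M / r * ‖w‖ := by positivity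
    linarith
  · have h1 : ‖W (x - w) - W x‖ ≤ 2 * M :=
      (norm_sub_le _ _).trans (by linarith [hM (x - w), hM x])
    have h2 : 2 * M ≤ 2 * M / r * ‖w‖ := by
      rw [div_mul_eq_mul_div, le_div_iff₀ hr]; gcongr; exact le_of_not_gt hw
    linarith

variable {E : Type*} [NormedAddCommGroup E] [InnerProductSpace ℝ E] [FiniteDimensional ℝ E]
  [MeasurableSpace E] [BorelSpace E]
variable {F : Type*} [NormedAddCommGroup F] [NormedSpace ℝ F]

lemma integrable_exp_neg_mul_sq {b : ℝ} (hb : 0 < b) :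
    Integrable (fun z : E => Real.exp (-b * ‖z‖ ^ 2)) := by
  refine Integrable.of_integral_ne_zero ?_
  rw [GaussianFourier.integral_rexp_neg_mul_sq_norm hb]
  positivity

lemma integrable_norm_mul_exp_neg_mul_sq {b : ℝ} (hb : 0 < b) :
    Integrable (fun z : E => ‖z‖ * Real.exp (-b * ‖z‖ ^ 2)) := by
  refine ((integrable_exp_neg_mul_sq (E := E) (half_pos hb)).const_mul (1 + 1 / b)).mono'
    (by fun_prop) (Eventually.of_forall fun z => ?_)
  rw [Real.norm_of_nonneg (by positivity)]
  have h1 : ‖z‖ ≤ (1 + 1 / b) * Real.exp (b / 2 * ‖z‖ ^ 2) := by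
    have h2 := Real.add_one_le_exp (b / 2 * ‖z‖ ^ 2)
    calc ‖z‖ ≤ (1 + 1 / b) * (b / 2 * ‖z‖ ^ 2 + 1) := by
          have : (1 + 1 / b) * (b / 2 * ‖z‖ ^ 2 + 1)
            = 1 + 1 / b + b / 2 * ‖z‖ ^ 2 + ‖z‖ ^ 2 / 2 := by field_simp; ring
          have h3 : 0 < 1 / b := by positivity
          have h4 : 0 ≤ b / 2 * ‖z‖ ^ 2 := by positivity
          nlinarith [sq_nonneg (‖z‖ - 1)]
      _ ≤ _ := by gcongr
  calc ‖z‖ * Real.exp (-b * ‖z‖ ^ 2)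
      ≤ ((1 + 1 / b) * Real.exp (b / 2 * ‖z‖ ^ 2)) * Real.exp (-b * ‖z‖ ^ 2) := by gcongr
    _ = _ := by rw [mul_assoc, ← Real.exp_add]; ring_nf

variable (E) in
/-- The total mass of the unnormalized Gaussian. -/
def gaussMass : ℝ := ∫ z : E, Real.exp (-1 * ‖z‖ ^ 2)

variable (E) in
lemma gaussMass_pos : 0 < gaussMass E := by
  rw [gaussMass, GaussianFourier.integral_rexp_neg_mul_sq_norm one_pos]
  positivity

/-- The normalized Gaussian. -/
def gaussKernel (z : E) : ℝ := (gaussMass E)⁻¹ * Real.exp (-1 * ‖z‖ ^ 2)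

lemma gaussKernel_nonneg (z : E) : 0 ≤ gaussKernel z := by
  have := gaussMass_pos E
  unfold gaussKernel; positivity

lemma continuous_gaussKernel : Continuous (gaussKernel : E → ℝ) := by
  unfold gaussKernel; fun_prop

lemma integrable_gaussKernel : Integrable (gaussKernel : E → ℝ) :=
  (integrable_exp_neg_mul_sq one_pos).const_mul _

lemma integral_gaussKernel : ∫ z : E, gaussKernel z = 1 := by
  unfold gaussKernel
  rw [integral_const_mul]
  exact inv_mul_cancel₀ (gaussMass_pos E).ne'

lemma integrable_gaussKernel_mul_norm : Integrable (fun z : E => gaussKernel z * ‖z‖) := by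
  refine ((integrable_norm_mul_exp_neg_mul_sq (E := E) one_pos).const_mul (gaussMass E)⁻¹).congr
    (Eventually.of_forall fun z => ?_)
  simp only [gaussKernel]; ring

/-- A Gaussian majorant of the difference quotients of `gaussKernel`. -/
def gaussMajorant (z : E) : ℝ :=
  (gaussMass E)⁻¹ * (5 * Real.exp 1) * Real.exp (-(1 / 4) * ‖z‖ ^ 2)

lemma integrable_gaussMajorant : Integrable (gaussMajorant : E → ℝ) :=
  (integrable_exp_neg_mul_sq (by norm_num)).const_mul _

lemma integrable_gaussMajorant_mul_norm : Integrable (fun z : E => gaussMajorant z * ‖z‖) := by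
  refine ((integrable_norm_mul_exp_neg_mul_sq (E := E) (b := 1 / 4) (by norm_num)).const_mul
    ((gaussMass E)⁻¹ * (5 * Real.exp 1))).congr (Eventually.of_forall fun z => ?_)
  simp only [gaussMajorant]; ring

lemma abs_exp_neg_sub_exp_neg_le {a b c : ℝ} (ha : c ≤ a) (hb : c ≤ b) :
    |Real.exp (-a) - Real.exp (-b)| ≤ |a - b| * Real.exp (-c) := by
  wlog hab : a ≤ b generalizing a b
  · rw [abs_sub_comm, abs_sub_comm a b]; exact this hb ha (le_of_not_ge hab)
  have h1 : Real.exp (-b) ≤ Real.exp (-a) := Real.exp_le_exp.2 (by linarith)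
  rw [abs_of_nonneg (by linarith), abs_of_nonpos (by linarith)]
  have h2 : Real.exp (-b) = Real.exp (-a) * Real.exp (a - b) := by rw [← Real.exp_add]; ring_nf
  have h3 := Real.add_one_le_exp (a - b)
  have h4 : Real.exp (-a) ≤ Real.exp (-c) := Real.exp_le_exp.2 (by linarith)
  have h5 := Real.exp_pos (-a)
  calc Real.exp (-a) - Real.exp (-b) ≤ Real.exp (-a) * (b - a) := by rw [h2]; nlinarith
    _ ≤ Real.exp (-c) * (b - a) := by gcongr
    _ = _ := by ring

/-- As `‖s‖ ≤ 1`, both exponents are at least `‖z‖² / 2 - 1`, and they differ by at most `‖s‖ (2 ‖z‖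
+ 1)`. Giving up a factor `exp (‖z‖² / 4)` absorbs the linear term, which leaves the decay rate 1/4
of the majorant. -/
lemma abs_gaussKernel_add_sub_le (z s : E) (hs : ‖s‖ ≤ 1) :
    |gaussKernel (z + s) - gaussKernel z| ≤ ‖s‖ * gaussMajorant z := by
  have hZ := gaussMass_pos E
  unfold gaussKernel gaussMajorant
  rw [← mul_sub, abs_mul, abs_of_pos (inv_pos.2 hZ)]
  have hn1 : ‖z + s‖ ≤ ‖z‖ + ‖s‖ := norm_add_le _ _
  have hn2 : ‖z‖ ≤ ‖z + s‖ + ‖s‖ := by simpa using norm_sub_le (z + s) s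
  have h0 := norm_nonneg z
  have h0s := norm_nonneg s
  have h0zs := norm_nonneg (z + s)
  have hA : ‖z‖ ^ 2 / 2 - 1 ≤ 1 * ‖z + s‖ ^ 2 := by
    nlinarith [sq_nonneg (‖z + s‖ - ‖s‖), mul_le_mul hn2 hn2 h0 (by positivity)]
  have hB : ‖z‖ ^ 2 / 2 - 1 ≤ 1 * ‖z‖ ^ 2 := by nlinarith
  have hdiff : |1 * ‖z + s‖ ^ 2 - 1 * ‖z‖ ^ 2| ≤ ‖s‖ * (2 * ‖z‖ + 1) := by
    rw [abs_le]; constructor <;> nlinarith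
  have key := abs_exp_neg_sub_exp_neg_le hA hB
  rw [neg_mul, neg_mul]
  have h5 : 2 * ‖z‖ + 1 ≤ 5 * Real.exp (‖z‖ ^ 2 / 4) := by
    have := Real.add_one_le_exp (‖z‖ ^ 2 / 4)
    nlinarith [sq_nonneg (‖z‖ - 1)]
  calc (gaussMass E)⁻¹ * |Real.exp (-(1 * ‖z + s‖ ^ 2)) - Real.exp (-(1 * ‖z‖ ^ 2))|
      ≤ (gaussMass E)⁻¹ * ((‖s‖ * (5 * Real.exp (‖z‖ ^ 2 / 4)))
          * Real.exp (-(‖z‖ ^ 2 / 2 - 1))) := by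
        gcongr
        refine key.trans ?_
        gcongr
        refine hdiff.trans ?_
        gcongr
    _ = ‖s‖ * ((gaussMass E)⁻¹ * (5 * (Real.exp (‖z‖ ^ 2 / 4)
          * Real.exp (-(‖z‖ ^ 2 / 2 - 1))))) := by ring
    _ = ‖s‖ * ((gaussMass E)⁻¹ * (5 * (Real.exp 1 * Real.exp (-(1 / 4) * ‖z‖ ^ 2)))) := by
        rw [← Real.exp_add, ← Real.exp_add]; ring_nf
    _ = _ := by ring

/-- Convolution with the Gaussian at scale `δ`. -/
def gaussMollify (δ : ℝ) (f : E → F) (x : E) : F := ∫ z, gaussKernel z • f (x - δ • z)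

lemma integrable_smul_comp_sub {k : E → ℝ} (hk : Integrable k) {W : E → F} (hW : Continuous W)
    (hc : HasCompactSupport W) (δ : ℝ) (x : E) :
    Integrable (fun z => k z • W (x - δ • z)) := by
  obtain ⟨M, hM⟩ := hW.bounded_above_of_compact_support hc
  exact hk.smul_bdd M (by fun_prop)
    (Eventually.of_forall fun z => hM _)

section Estimates

variable [CompleteSpace F] {W : E → F} {a C δ : ℝ}

lemma norm_gaussMollify_sub_le (hW : Continuous W) (hc : HasCompactSupport W)
    (hmod : ∀ x w, ‖W (x - w) - W x‖ ≤ a + C * ‖w‖) (hδ : 0 < δ) (x : E) :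
    ‖gaussMollify δ W x - W x‖ ≤ a + δ * (C * ∫ z : E, gaussKernel z * ‖z‖) := by
  have h1 : W x = ∫ z : E, gaussKernel z • W x := by
    rw [integral_smul_const, integral_gaussKernel, one_smul]
  have h2 : gaussMollify δ W x - W x = ∫ z : E, gaussKernel z • (W (x - δ • z) - W x) := by
    conv_lhs => rw [h1]
    unfold gaussMollify
    rw [← integral_sub (integrable_smul_comp_sub integrable_gaussKernel hW hc δ x)
      (integrable_gaussKernel.smul_const _)]
    simp only [smul_sub]
  rw [h2]
  have h3 : a + δ * (C * ∫ z : E, gaussKernel z * ‖z‖)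
      = ∫ z : E, (a * gaussKernel z + δ * C * (gaussKernel z * ‖z‖)) := by
    rw [integral_add (integrable_gaussKernel.const_mul _)
      (integrable_gaussKernel_mul_norm.const_mul _), integral_const_mul, integral_const_mul,
      integral_gaussKernel]
    ring
  rw [h3]
  refine norm_integral_le_of_norm_le ((integrable_gaussKernel.const_mul _).add
      (integrable_gaussKernel_mul_norm.const_mul _)) (Eventually.of_forall fun z => ?_)
  rw [norm_smul, Real.norm_of_nonneg (gaussKernel_nonneg z)]
  calc gaussKernel z * ‖W (x - δ • z) - W x‖ ≤ gaussKernel z * (a + C * ‖δ • z‖) := by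
        gcongr
        · exact gaussKernel_nonneg z
        · exact hmod _ _
    _ = _ := by rw [norm_smul, Real.norm_of_nonneg hδ.le]; ring

/-- The increment is shifted from `W` to the kernel. Kernel differences have integral zero, so `W x`
may be subtracted under the integral, and only the modulus of continuity of `W` enters. -/
lemma norm_gaussMollify_add_sub_le (hW : Continuous W) (hc : HasCompactSupport W)
    (hmod : ∀ x w, ‖W (x - w) - W x‖ ≤ a + C * ‖w‖) (hδ : 0 < δ) (x s : E) (hs : ‖s‖ ≤ 1) :
    ‖gaussMollify δ W (x + δ • s) - gaussMollify δ W x‖ ≤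
      ‖s‖ * (a * (∫ z : E, gaussMajorant z) + δ * (C * ∫ z : E, gaussMajorant z * ‖z‖)) := by
  have hks : Integrable (fun z : E => gaussKernel (z + s)) := integrable_gaussKernel.comp_add_right s
  have h1 : gaussMollify δ W (x + δ • s) = ∫ z : E, gaussKernel (z + s) • W (x - δ • z) := by
    unfold gaussMollify
    rw [← integral_add_right_eq_self (fun z : E => gaussKernel z • W (x + δ • s - δ • z)) s]
    refine integral_congr_ae (Eventually.of_forall fun z => ?_)
    simp only [smul_add]
    congr 2
    abel
  have h0 : ∫ z : E, (gaussKernel (z + s) - gaussKernel z) • W x = 0 := by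
    rw [integral_smul_const, integral_sub hks integrable_gaussKernel,
      integral_add_right_eq_self, sub_self, zero_smul]
  have hd : Integrable (fun z : E => gaussKernel (z + s) - gaussKernel z) :=
    hks.sub integrable_gaussKernel
  have hi := integrable_smul_comp_sub hd hW hc δ x
  have h2 : gaussMollify δ W (x + δ • s) - gaussMollify δ W x =
      ∫ z : E, (gaussKernel (z + s) - gaussKernel z) • (W (x - δ • z) - W x) := by
    rw [h1, gaussMollify, ← integral_sub (integrable_smul_comp_sub hks hW hc δ x)
      (integrable_smul_comp_sub integrable_gaussKernel hW hc δ x)]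
    simp only [smul_sub]
    rw [integral_sub hi (hd.smul_const _), h0, sub_zero]
    simp only [sub_smul]
  have h3 : ‖s‖ * (a * (∫ z : E, gaussMajorant z) + δ * (C * ∫ z : E, gaussMajorant z * ‖z‖))
      = ∫ z : E, (‖s‖ * a * gaussMajorant z + ‖s‖ * δ * C * (gaussMajorant z * ‖z‖)) := by
    rw [integral_add (integrable_gaussMajorant.const_mul _)
      (integrable_gaussMajorant_mul_norm.const_mul _), integral_const_mul, integral_const_mul]
    ring
  rw [h2, h3]
  refine norm_integral_le_of_norm_le ((integrable_gaussMajorant.const_mul _).add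
      (integrable_gaussMajorant_mul_norm.const_mul _)) (Eventually.of_forall fun z => ?_)
  rw [norm_smul, Real.norm_eq_abs]
  calc |gaussKernel (z + s) - gaussKernel z| * ‖W (x - δ • z) - W x‖
      ≤ (‖s‖ * gaussMajorant z) * (a + C * ‖δ • z‖) := by
        have h := abs_gaussKernel_add_sub_le z s hs
        exact mul_le_mul h (hmod _ _) (norm_nonneg _) ((abs_nonneg _).trans h)
    _ = _ := by rw [norm_smul, Real.norm_of_nonneg hδ.le]; ring

/-- An increment of length `δ ‖s‖` changes the mollification by `‖s‖` times a quantity that is small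
with `a` and `δ`. For `W = D²u` this says that the third derivative of the mollification is
`o(1/δ)`, although `W` is merely continuous. -/
lemma norm_fderiv_gaussMollify_le (hW : Continuous W) (hc : HasCompactSupport W)
    (hmod : ∀ x w, ‖W (x - w) - W x‖ ≤ a + C * ‖w‖) (hδ : 0 < δ) (x : E) (ha : 0 ≤ a) (hC : 0 ≤ C) :
    δ * ‖fderiv ℝ (gaussMollify δ W) x‖ ≤
      a * (∫ z : E, gaussMajorant z) + δ * (C * ∫ z : E, gaussMajorant z * ‖z‖) := by
  have hpos : ∀ z : E, 0 ≤ gaussMajorant z := fun z => by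
    have := gaussMass_pos E
    unfold gaussMajorant; positivity
  have hI0 : 0 ≤ ∫ z : E, gaussMajorant z := integral_nonneg hpos
  have hI1 : 0 ≤ ∫ z : E, gaussMajorant z * ‖z‖ :=
    integral_nonneg fun z => mul_nonneg (hpos z) (norm_nonneg z)
  set B := a * (∫ z : E, gaussMajorant z) + δ * (C * ∫ z : E, gaussMajorant z * ‖z‖)
  have hB : 0 ≤ B := by positivity
  have : ‖fderiv ℝ (gaussMollify δ W) x‖ ≤ B / δ := by
    refine norm_fderiv_le_of_lip' ℝ (by positivity) ?_
    filter_upwards [Metric.ball_mem_nhds x hδ] with y hy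
    have h := norm_gaussMollify_add_sub_le hW hc hmod hδ x (δ⁻¹ • (y - x)) (by
      rw [norm_smul, Real.norm_of_nonneg (by positivity), inv_mul_le_iff₀ hδ, mul_one]
      exact (mem_ball_iff_norm.1 hy).le)
    rw [smul_smul, mul_inv_cancel₀ hδ.ne', one_smul, add_sub_cancel, norm_smul,
      Real.norm_of_nonneg (by positivity)] at h
    refine h.trans (le_of_eq ?_)
    change _ * B = _
    field_simp
  rwa [le_div_iff₀' hδ] at this

end Estimates

lemma hasFDerivAt_gaussMollify [CompleteSpace F] {W : E → F} (hW : ContDiff ℝ 1 W)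
    (hc : HasCompactSupport W) (δ : ℝ) (x : E) :
    HasFDerivAt (gaussMollify δ W) (gaussMollify δ (fderiv ℝ W) x) x := by
  have hD : Continuous (fderiv ℝ W) := hW.continuous_fderiv one_ne_zero
  have hcD : HasCompactSupport (fderiv ℝ W) := hc.fderiv ℝ
  obtain ⟨M, hM⟩ := hD.bounded_above_of_compact_support hcD
  have hk : Continuous (gaussKernel : E → ℝ) := continuous_gaussKernel
  have hW' := hW.continuous
  refine hasFDerivAt_integral_of_dominated_of_fderiv_le (s := univ)
    (F := fun x z => gaussKernel z • W (x - δ • z))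
    (F' := fun x z => gaussKernel z • fderiv ℝ W (x - δ • z))
    (bound := fun z => gaussKernel z * M) univ_mem
    (Eventually.of_forall fun y => by fun_prop)
    (integrable_smul_comp_sub integrable_gaussKernel hW' hc δ x)
    (integrable_smul_comp_sub integrable_gaussKernel hD hcD δ x).1
    (Eventually.of_forall fun z y _ => ?_) (integrable_gaussKernel.mul_const _)
    (Eventually.of_forall fun z y _ => ?_)
  · rw [norm_smul, Real.norm_of_nonneg (gaussKernel_nonneg z)]
    exact mul_le_mul_of_nonneg_left (hM _) (gaussKernel_nonneg z)
  · exact ((hasFDerivAt_comp_sub _).2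
      ((hW.differentiable one_ne_zero) (y - δ • z)).hasFDerivAt).const_smul _

/-- Expanding `‖x - y‖²` shows that the exponent, as a function of `y` on the compact support of
`f`, depends polynomially on `x` with values in the Banach algebra `C(tsupport f, ℝ)`. The
exponential of that algebra is analytic, and integration against `f` is a continuous linear
functional. -/
lemma contDiff_integral_exp_mul {f : E → ℝ} (hf : Continuous f) (hc : HasCompactSupport f)
    (b : ℝ) : ContDiff ℝ ω (fun x => ∫ y, Real.exp (-b * ‖x - y‖ ^ 2) * f y) := by
  have hK : IsCompact (tsupport f) := hc
  have : CompactSpace (tsupport f) := isCompact_iff_compactSpace.1 hK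
  let μ : Measure (tsupport f) := (volume : Measure E).comap (↑)
  have hint : Integrable (fun y : tsupport f => f y) μ := by
    have := hf.integrable_of_hasCompactSupport (μ := volume) hc
    exact (MeasurableEmbedding.subtype_coe
      (isClosed_tsupport f).measurableSet).integrableOn_range_iff_comap.1 this.integrableOn
  have hmul : ∀ φ : C(tsupport f, ℝ), Integrable (fun y => φ y * f y) μ := fun φ =>
    hint.bdd_mul (c := ‖φ‖) (by fun_prop) (Eventually.of_forall fun y => φ.norm_coe_le_norm y)
  let Λ : C(tsupport f, ℝ) →L[ℝ] ℝ := LinearMap.mkContinuous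
    { toFun := fun φ => ∫ y, φ y * f y ∂μ
      map_add' := fun φ ψ => by
        simp only [ContinuousMap.add_apply, add_mul]; exact integral_add (hmul φ) (hmul ψ)
      map_smul' := fun c φ => by
        simp only [ContinuousMap.smul_apply, smul_eq_mul, mul_assoc, RingHom.id_apply]
        exact integral_const_mul _ _ }
    (∫ y, ‖f y‖ ∂μ) (fun φ => by
      refine (norm_integral_le_of_norm_le (hint.norm.const_mul ‖φ‖)
        (Eventually.of_forall fun y => ?_)).trans (le_of_eq ?_)
      · rw [norm_mul]; gcongr; exact φ.norm_coe_le_norm y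
      · rw [integral_const_mul, mul_comm])
  let L : E →ₗ[ℝ] C(tsupport f, ℝ) :=
    { toFun := fun x => ⟨fun y => ⟪x, (y : E)⟫_ℝ, by fun_prop⟩
      map_add' := fun x y => by ext; simp [inner_add_left]
      map_smul' := fun c x => by ext; simp [inner_smul_left] }
  let L' : E →L[ℝ] C(tsupport f, ℝ) := LinearMap.toContinuousLinearMap L
  let N : C(tsupport f, ℝ) := ⟨fun y => ‖(y : E)‖ ^ 2, by fun_prop⟩
  have hq : ContDiff ℝ ω (fun x : E => (-b) • (‖x‖ ^ 2 • (1 : C(tsupport f, ℝ))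
      - (2 : ℝ) • L' x + N)) := by
    have h1 : ContDiff ℝ ω (fun x : E => ‖x‖ ^ 2) := contDiff_norm_sq ℝ
    have h2 : ContDiff ℝ ω L' := L'.contDiff
    fun_prop
  have hexp : ContDiff ℝ ω (NormedSpace.exp : C(tsupport f, ℝ) → C(tsupport f, ℝ)) :=
    contDiff_iff_contDiffAt.2 fun φ => (NormedSpace.exp_analytic (𝕂 := ℝ) φ).contDiffAt
  have heval : ∀ (φ : C(tsupport f, ℝ)) (y : tsupport f),
      (NormedSpace.exp φ) y = Real.exp (φ y) := fun φ y => by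
    have := NormedSpace.map_exp (ContinuousMap.evalAlgHom ℝ ℝ y)
      (continuous_eval_const (F := C(tsupport f, ℝ)) y) φ
    rw [Real.exp_eq_exp_ℝ]
    exact this
  convert! Λ.contDiff.comp (hexp.comp hq) using 1
  ext x
  have h3 : ∫ y, Real.exp (-b * ‖x - y‖ ^ 2) * f y
      = ∫ y in tsupport f, Real.exp (-b * ‖x - y‖ ^ 2) * f y := by
    refine (setIntegral_eq_integral_of_forall_compl_eq_zero fun y hy => ?_).symm
    rw [image_eq_zero_of_notMem_tsupport hy, mul_zero]
  rw [h3, ← integral_subtype_comap (isClosed_tsupport f).measurableSet]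
  refine integral_congr_ae (Eventually.of_forall fun y => ?_)
  simp only [Function.comp_apply]
  rw [heval]
  congr 2
  simp only [ContinuousMap.smul_apply, ContinuousMap.add_apply, ContinuousMap.sub_apply, L', L, N,
    smul_eq_mul, LinearMap.coe_toContinuousLinearMap', LinearMap.coe_mk, AddHom.coe_mk,
    ContinuousMap.coe_mk, ContinuousMap.one_apply]
  rw [norm_sub_sq_real]
  ring

/-- The substitution `y = x - δ z` moves `x` out of `f` into the Gaussian, so continuity of `f`
suffices. -/
lemma contDiff_gaussMollify {f : E → ℝ} (hf : Continuous f) (hc : HasCompactSupport f) {δ : ℝ}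
    (hδ : 0 < δ) : ContDiff ℝ ω (gaussMollify δ f) := by
  have key : ∀ x, gaussMollify δ f x = |(δ ^ Module.finrank ℝ E)⁻¹| * ((gaussMass E)⁻¹ *
      ∫ y, Real.exp (-(δ⁻¹ ^ 2) * ‖x - y‖ ^ 2) * f y) := fun x => by
    have h1 := Measure.integral_comp_smul (volume : Measure E)
      (fun w => gaussKernel (δ⁻¹ • w) • f (x - w)) δ
    simp only [smul_smul, inv_mul_cancel₀ hδ.ne', one_smul] at h1
    rw [gaussMollify, h1, smul_eq_mul]
    congr 1
    rw [← integral_sub_left_eq_self _ volume x, ← integral_const_mul]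
    refine integral_congr_ae (Eventually.of_forall fun y => ?_)
    simp only [gaussKernel, sub_sub_cancel, norm_smul, smul_eq_mul, mul_pow, norm_inv, inv_pow,
      Real.norm_eq_abs, sq_abs]
    ring_nf
  rw [funext key]
  exact contDiff_const.mul (contDiff_const.mul (contDiff_integral_exp_mul hf hc _))

/-- The fourth bound is the one that matters: the factor `δ` gained in `|v - u|` from the Lipschitz
continuity of `u` pays for the `1/δ` in the third derivative. The order of choices is `a`, then the
moduli `C` and `C'`, which depend on `a`, then `δ`. -/
theorem exists_analytic_approx {u : E → ℝ} (hu : ContDiff ℝ 2 u) (hc : HasCompactSupport u)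
    {η : ℝ} (hη : 0 < η) : ∃ v : E → ℝ, ContDiff ℝ ω v ∧ ∀ x, |v x - u x| ≤ η ∧
      ‖fderiv ℝ v x - fderiv ℝ u x‖ ≤ η ∧
      ‖fderiv ℝ (fderiv ℝ v) x - fderiv ℝ (fderiv ℝ u) x‖ ≤ η ∧
      |v x - u x| * ‖fderiv ℝ (fderiv ℝ (fderiv ℝ v)) x‖ ≤ η := by
  have hu1 : ContDiff ℝ 1 u := hu.of_le (by norm_num)
  have hDu : ContDiff ℝ 1 (fderiv ℝ u) := hu.fderiv_right (by norm_num)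
  have hcD : HasCompactSupport (fderiv ℝ u) := hc.fderiv ℝ
  have hDDu : Continuous (fderiv ℝ (fderiv ℝ u)) := hDu.continuous_fderiv one_ne_zero
  have hcDD : HasCompactSupport (fderiv ℝ (fderiv ℝ u)) := hcD.fderiv ℝ
  obtain ⟨L, hL⟩ := hDu.continuous.bounded_above_of_compact_support hcD
  have hL0 : 0 ≤ L := (norm_nonneg _).trans (hL 0)
  set m := ∫ z : E, gaussKernel z * ‖z‖
  set I := ∫ z : E, gaussMajorant z
  set J := ∫ z : E, gaussMajorant z * ‖z‖
  have hm : 0 ≤ m := integral_nonneg fun z => mul_nonneg (gaussKernel_nonneg z) (norm_nonneg z)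
  obtain ⟨a, ha, haη, haI⟩ : ∃ a : ℝ, 0 < a ∧ a < η ∧ L * m * (a * I) < η := by
    have h1 : ∀ᶠ a in 𝓝[>] (0 : ℝ), L * m * (a * I) < η := by
      have : Tendsto (fun a : ℝ => L * m * (a * I)) (𝓝[>] 0) (𝓝 (L * m * (0 * I))) :=
        ((by fun_prop : Continuous fun a : ℝ => L * m * (a * I)).tendsto 0).mono_left
          nhdsWithin_le_nhds
      exact this.eventually_lt_const (by simpa using hη)
    have h2 : ∀ᶠ a in 𝓝[>] (0 : ℝ), a < η := nhdsWithin_le_nhds (gt_mem_nhds hη)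
    obtain ⟨a, ha⟩ := (h1.and (h2.and self_mem_nhdsWithin)).exists
    exact ⟨a, ha.2.2, ha.2.1, ha.1⟩
  obtain ⟨C, hC, hmod⟩ := exists_norm_sub_le_add_mul hDu.continuous hcD ha
  obtain ⟨C', hC', hmod'⟩ := exists_norm_sub_le_add_mul hDDu hcDD ha
  -- The additive constant in the modulus is 0 here, so the error of the function itself is
  -- proportional to `δ`.
  have hmod0 : ∀ x w, ‖u (x - w) - u x‖ ≤ 0 + L * ‖w‖ := fun x w => by
    have := convex_univ.norm_image_sub_le_of_norm_fderiv_le (𝕜 := ℝ) (f := u) (C := L)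
      (fun y _ => (hu1.differentiable one_ne_zero) y) (fun y _ => hL y) (mem_univ x)
      (mem_univ (x - w))
    simpa using this
  obtain ⟨δ, hδ, h0, h1, h2, h3⟩ : ∃ δ : ℝ, 0 < δ ∧ 0 + δ * (L * m) < η ∧ a + δ * (C * m) < η ∧
      a + δ * (C' * m) < η ∧ L * m * (a * I + δ * (C' * J)) < η := by
    have aux : ∀ f : ℝ → ℝ, Continuous f → f 0 < η → ∀ᶠ δ in 𝓝[>] (0 : ℝ), f δ < η :=
      fun f hf hf0 => ((hf.tendsto 0).mono_left nhdsWithin_le_nhds).eventually_lt_const hf0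
    obtain ⟨δ, hδ⟩ := ((aux (fun δ => 0 + δ * (L * m)) (by fun_prop) (by simpa using hη)).and
      ((aux (fun δ => a + δ * (C * m)) (by fun_prop) (by simpa using haη)).and
      ((aux (fun δ => a + δ * (C' * m)) (by fun_prop) (by simpa using haη)).and
      ((aux (fun δ => L * m * (a * I + δ * (C' * J))) (by fun_prop) (by simpa using haI)).and
      self_mem_nhdsWithin)))).exists
    exact ⟨δ, hδ.2.2.2.2, hδ.1, hδ.2.1, hδ.2.2.1, hδ.2.2.2.1⟩
  have e1 : fderiv ℝ (gaussMollify δ u) = gaussMollify δ (fderiv ℝ u) :=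
    funext fun x => (hasFDerivAt_gaussMollify hu1 hc δ x).fderiv
  have e2 : fderiv ℝ (gaussMollify δ (fderiv ℝ u)) = gaussMollify δ (fderiv ℝ (fderiv ℝ u)) :=
    funext fun x => (hasFDerivAt_gaussMollify hDu hcD δ x).fderiv
  refine ⟨gaussMollify δ u, contDiff_gaussMollify hu.continuous hc hδ, fun x => ?_⟩
  rw [e1, e2]
  have b0 := norm_gaussMollify_sub_le hu.continuous hc hmod0 hδ x
  refine ⟨b0.trans h0.le, (norm_gaussMollify_sub_le hDu.continuous hcD hmod hδ x).trans h1.le,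
    (norm_gaussMollify_sub_le hDDu hcDD hmod' hδ x).trans h2.le, ?_⟩
  have b3 := norm_fderiv_gaussMollify_le hDDu hcDD hmod' hδ x ha.le hC'
  rw [zero_add] at b0
  calc |gaussMollify δ u x - u x| * ‖fderiv ℝ (gaussMollify δ (fderiv ℝ (fderiv ℝ u))) x‖
      ≤ δ * (L * m) * ‖fderiv ℝ (gaussMollify δ (fderiv ℝ (fderiv ℝ u))) x‖ := by gcongr; exact b0
    _ = L * m * (δ * ‖fderiv ℝ (gaussMollify δ (fderiv ℝ (fderiv ℝ u))) x‖) := by ring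
    _ ≤ L * m * (a * I + δ * (C' * J)) := by gcongr
    _ ≤ η := h3.le

end Mollification

/-! ### Derivatives of the normalized gradient. -/

section UnitNormal

variable {E : Type*} [NormedAddCommGroup E] [InnerProductSpace ℝ E] [FiniteDimensional ℝ E]

/-- The unit vector representing the direction of a nonzero functional. -/
def dualDirection (l : E →L[ℝ] ℝ) : E := ‖l‖⁻¹ • (InnerProductSpace.toDual ℝ E).symm l

/-- The unit normal field `∇h / |∇h|` of the level sets of `h`. -/
def unitNormal (h : E → ℝ) (p : E) : E := dualDirection (fderiv ℝ h p)

lemma norm_dualDirection {l : E →L[ℝ] ℝ} (hl : l ≠ 0) : ‖dualDirection l‖ = 1 := by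
  rw [dualDirection, norm_smul, LinearIsometryEquiv.norm_map, norm_inv, norm_norm,
    inv_mul_cancel₀ (norm_ne_zero_iff.2 hl)]

lemma apply_dualDirection (l : E →L[ℝ] ℝ) : l (dualDirection l) = ‖l‖ := by
  have h : l ((InnerProductSpace.toDual ℝ E).symm l) = ‖l‖ * ‖l‖ := by
    conv_lhs => rw [← InnerProductSpace.toDual_symm_apply (𝕜 := ℝ) (y := l)]
    rw [real_inner_self_eq_norm_mul_norm, LinearIsometryEquiv.norm_map]
  rw [dualDirection, map_smul, h, smul_eq_mul]
  by_cases h0 : ‖l‖ = 0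
  · simp [h0]
  · field_simp

lemma inner_dualDirection (l : E →L[ℝ] ℝ) (w : E) : ⟪dualDirection l, w⟫_ℝ = ‖l‖⁻¹ * l w := by
  rw [dualDirection, real_inner_smul_left, InnerProductSpace.toDual_symm_apply]

lemma contDiffAt_dualDirection {l : E →L[ℝ] ℝ} (hl : l ≠ 0) {n : WithTop ℕ∞} :
    ContDiffAt ℝ n (dualDirection : (E →L[ℝ] ℝ) → E) l := by
  have hJ : ContDiffAt ℝ n ((InnerProductSpace.toDual ℝ E).symm : (E →L[ℝ] ℝ) → E) l :=
    (InnerProductSpace.toDual ℝ E).symm.contDiff.contDiffAt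
  have hn : ContDiffAt ℝ n (fun l : E →L[ℝ] ℝ => ‖l‖) l := by
    have h1 := hJ.norm ℝ (by simpa using hl)
    simpa using h1
  exact (hn.inv (norm_ne_zero_iff.2 hl)).smul hJ

/-- The shell `b ≤ ‖l‖ ≤ M` is compact and avoids 0, where alone smoothness of the direction map
fails. -/
lemma exists_bound_fderiv_dualDirection {b : ℝ} (hb : 0 < b) (M : ℝ) :
    ∃ C, 0 ≤ C ∧ ∀ l : E →L[ℝ] ℝ, b ≤ ‖l‖ → ‖l‖ ≤ M →
      ‖fderiv ℝ dualDirection l‖ ≤ C ∧ ‖fderiv ℝ (fderiv ℝ dualDirection) l‖ ≤ C := by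
  let K : Set (E →L[ℝ] ℝ) := Metric.closedBall 0 M ∩ {l | b ≤ ‖l‖}
  have : ProperSpace (E →L[ℝ] ℝ) := FiniteDimensional.proper ℝ _
  have hK : IsCompact K := (isCompact_closedBall _ _).inter_right
    (isClosed_le continuous_const continuous_norm)
  have hne : ∀ l ∈ K, l ≠ 0 := fun l hl => by
    rintro rfl
    have := hl.2
    simp only [mem_ofPred_eq, norm_zero] at this
    linarith
  have h1 : ∀ l ∈ K, ContDiffAt ℝ 1 (fderiv ℝ (dualDirection : (E →L[ℝ] ℝ) → E)) l := fun l hl =>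
    (contDiffAt_dualDirection (hne l hl) (n := 2)).fderiv_right (by norm_num)
  obtain ⟨C1, hC1⟩ := hK.exists_bound_of_continuousOn
    (f := fderiv ℝ (dualDirection : (E →L[ℝ] ℝ) → E))
    fun l hl => (h1 l hl).continuousAt.continuousWithinAt
  obtain ⟨C2, hC2⟩ := hK.exists_bound_of_continuousOn
    (f := fderiv ℝ (fderiv ℝ (dualDirection : (E →L[ℝ] ℝ) → E)))
    fun l hl => ((h1 l hl).fderiv_right (m := 0) (by norm_num)).continuousAt.continuousWithinAt
  refine ⟨max 0 (max C1 C2), le_max_left _ _, fun l hl hl' => ?_⟩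
  have hlK : l ∈ K := ⟨by simpa using hl', hl⟩
  exact ⟨(hC1 l hlK).trans ((le_max_left _ _).trans (le_max_right _ _)),
    (hC2 l hlK).trans ((le_max_right _ _).trans (le_max_right _ _))⟩

lemma contDiffAt_unitNormal {h : E → ℝ} {n : WithTop ℕ∞} (hh : ContDiff ℝ ω h) {p : E}
    (hp : fderiv ℝ h p ≠ 0) (hn : n + 1 ≤ ω) : ContDiffAt ℝ n (unitNormal h) p :=
  (contDiffAt_dualDirection hp).comp p (hh.fderiv_right hn).contDiffAt

/-- By the chain rule the second derivative of the normal is affine in `D³h` with coefficients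
bounded through `b` and `M`. The constant does not depend on `h`, so it can be fixed before the
approximation is chosen. -/
lemma exists_bound_fderiv_unitNormal {b : ℝ} (hb : 0 < b) {M : ℝ} (hM : 0 ≤ M) :
    ∃ K, 0 ≤ K ∧ ∀ h : E → ℝ, ContDiff ℝ ω h → ∀ p, b ≤ ‖fderiv ℝ h p‖ → ‖fderiv ℝ h p‖ ≤ M →
      ‖fderiv ℝ (fderiv ℝ h) p‖ ≤ M → ‖fderiv ℝ (unitNormal h) p‖ ≤ K ∧
      ‖fderiv ℝ (fderiv ℝ (unitNormal h)) p‖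
        ≤ K * (1 + ‖fderiv ℝ (fderiv ℝ (fderiv ℝ h)) p‖) := by
  obtain ⟨C, hC, hbd⟩ := exists_bound_fderiv_dualDirection (E := E) hb M
  refine ⟨C * M + C * M * M + C, by positivity, fun h hh p hb1 hM1 hM2 => ?_⟩
  obtain ⟨hd1, hd2⟩ := hbd _ hb1 hM1
  have hD : ContDiff ℝ ω (fderiv ℝ h) := hh.fderiv_right (by simp)
  have hDD : ContDiff ℝ ω (fderiv ℝ (fderiv ℝ h)) := hD.fderiv_right (by simp)
  have hpne : fderiv ℝ h p ≠ 0 := norm_ne_zero_iff.1 (by linarith)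
  have hev : ∀ᶠ q in 𝓝 p, fderiv ℝ h q ≠ 0 :=
    hD.continuous.continuousAt.eventually_ne hpne
  have hfd : ∀ q, fderiv ℝ h q ≠ 0 → HasFDerivAt (unitNormal h)
      ((fderiv ℝ dualDirection (fderiv ℝ h q)) ∘L (fderiv ℝ (fderiv ℝ h) q)) q := fun q hq =>
    HasFDerivAt.comp q ((contDiffAt_dualDirection hq (n := 1)).differentiableAt
      one_ne_zero).hasFDerivAt ((hD.differentiable (by simp)) q).hasFDerivAt
  have hev2 : fderiv ℝ (unitNormal h) =ᶠ[𝓝 p] fun q =>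
      (fderiv ℝ dualDirection (fderiv ℝ h q)) ∘L (fderiv ℝ (fderiv ℝ h) q) :=
    hev.mono fun q hq => (hfd q hq).fderiv
  have h1 : HasFDerivAt (fun q => fderiv ℝ (dualDirection : (E →L[ℝ] ℝ) → E) (fderiv ℝ h q))
      ((fderiv ℝ (fderiv ℝ dualDirection) (fderiv ℝ h p)) ∘L (fderiv ℝ (fderiv ℝ h) p)) p :=
    HasFDerivAt.comp p ((((contDiffAt_dualDirection hpne (n := 2)).fderiv_right (m := 1)
      (by norm_num)).differentiableAt one_ne_zero).hasFDerivAt)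
      ((hD.differentiable (by simp)) p).hasFDerivAt
  have h2 := h1.clm_comp ((hDD.differentiable (by simp)) p).hasFDerivAt
  constructor
  · rw [(hfd p hpne).fderiv]
    calc _ ≤ ‖fderiv ℝ dualDirection (fderiv ℝ h p)‖ * ‖fderiv ℝ (fderiv ℝ h) p‖ :=
          ContinuousLinearMap.opNorm_comp_le _ _
      _ ≤ C * M := by gcongr
      _ ≤ _ := by
        have : 0 ≤ C * M * M := by positivity
        linarith
  · rw [hev2.fderiv_eq, h2.fderiv]
    set T := fderiv ℝ (fderiv ℝ (fderiv ℝ h)) p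
    refine ContinuousLinearMap.opNorm_le_bound _ (by positivity) fun w => ?_
    have e : ∀ w : E, ‖fderiv ℝ dualDirection (fderiv ℝ h p) ∘L (T w)
        + ((fderiv ℝ (fderiv ℝ dualDirection) (fderiv ℝ h p)) (fderiv ℝ (fderiv ℝ h) p w))
          ∘L (fderiv ℝ (fderiv ℝ h) p)‖ ≤ C * (‖T‖ * ‖w‖) + C * (M * ‖w‖) * M := fun w => by
      refine (norm_add_le _ _).trans (add_le_add ?_ ?_)
      · refine (ContinuousLinearMap.opNorm_comp_le _ _).trans ?_
        gcongr
        exact T.le_opNorm w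
      · refine (ContinuousLinearMap.opNorm_comp_le _ _).trans ?_
        gcongr
        refine (ContinuousLinearMap.le_opNorm _ _).trans ?_
        gcongr
        refine (ContinuousLinearMap.le_opNorm _ _).trans ?_
        gcongr
    refine (e w).trans ?_
    have h3 : 0 ≤ C * M * M * ‖T‖ * ‖w‖ := by positivity
    have h4 : 0 ≤ C * M * ‖T‖ * ‖w‖ := by positivity
    have h5 : 0 ≤ C * M * ‖w‖ := by positivity
    have h6 : 0 ≤ C * ‖w‖ := by positivity
    nlinarith

end UnitNormal

/-! ### The graph function over the approximating level sets and its derivatives. -/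

section GraphFunction

lemma mul_sub_le_image_sub_of_le_hasDerivAt {φ φ' : ℝ → ℝ} {c τ : ℝ}
    (hφ : ∀ t, HasDerivAt φ (φ' t) t) (hc : ∀ t ∈ Icc (-τ) τ, c ≤ φ' t) :
    ∀ s ∈ Icc (-τ) τ, ∀ t ∈ Icc (-τ) τ, s ≤ t → c * (t - s) ≤ φ t - φ s :=
  (convex_Icc (-τ) τ).mul_sub_le_image_sub_of_le_deriv
    (fun t _ => (hφ t).continuousAt.continuousWithinAt)
    (fun t _ => (hφ t).differentiableAt.differentiableWithinAt)
    (fun t ht => by rw [(hφ t).deriv]; exact hc t (interior_subset ht))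

lemma exists_zero_of_le_hasDerivAt {φ φ' : ℝ → ℝ} {c τ : ℝ} (hc0 : 0 < c)
    (hφ : ∀ t, HasDerivAt φ (φ' t) t) (hc : ∀ t ∈ Icc (-τ) τ, c ≤ φ' t) (h0 : |φ 0| / c ≤ τ) :
    ∃ t, φ t = 0 ∧ |t| ≤ |φ 0| / c := by
  set s := |φ 0| / c
  have hs : 0 ≤ s := by positivity
  have hcs : c * s = |φ 0| := by simp only [s]; field_simp
  have hmono := mul_sub_le_image_sub_of_le_hasDerivAt hφ hc
  have h1 := hmono 0 ⟨by linarith, by linarith⟩ s ⟨by linarith, h0⟩ hs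
  have h2 := hmono (-s) ⟨by linarith, by linarith⟩ 0 ⟨by linarith, by linarith⟩ (by linarith)
  have h3 := neg_abs_le (φ 0)
  have h4 := le_abs_self (φ 0)
  have hmem : (0 : ℝ) ∈ Icc (φ (-s)) (φ s) := ⟨by linarith, by linarith⟩
  obtain ⟨t, ht, ht0⟩ := intermediate_value_Icc (by linarith : -s ≤ s)
    (fun t _ => (hφ t).continuousAt.continuousWithinAt) hmem
  exact ⟨t, ht0, abs_le.2 ht⟩

lemma eq_of_le_hasDerivAt {φ φ' : ℝ → ℝ} {c τ : ℝ} (hc0 : 0 < c)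
    (hφ : ∀ t, HasDerivAt φ (φ' t) t) (hc : ∀ t ∈ Icc (-τ) τ, c ≤ φ' t) {s t : ℝ}
    (hs : |s| ≤ τ) (ht : |t| ≤ τ) (h : φ s = φ t) : s = t := by
  wlog hst : s ≤ t generalizing s t
  · exact (this ht hs h.symm (le_of_not_ge hst)).symm
  have := mul_sub_le_image_sub_of_le_hasDerivAt hφ hc s (abs_le.1 hs) t (abs_le.1 ht) hst
  nlinarith

variable {E : Type*} [NormedAddCommGroup E] [InnerProductSpace ℝ E]

/-- Smoothness of the solution `t = ρ p` of `g (p + t • ν p) = h p` when it is locally unique. -/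
lemma contDiffAt_of_unique_solution [CompleteSpace E] {g h ρ : E → ℝ} {ν : E → E} {N : Set E} {τ : ℝ} {p : E}
    (hN : N ∈ 𝓝 p) (hg : ContDiff ℝ 2 g) (hh : ContDiff ℝ 2 h) (hν : ContDiffAt ℝ 2 ν p)
    (hρ : |ρ p| < τ) (hsol : ∀ q ∈ N, g (q + ρ q • ν q) = h q)
    (huniq : ∀ q ∈ N, ∀ t, |t| < τ → g (q + t • ν q) = h q → t = ρ q)
    (hA : fderiv ℝ g (p + ρ p • ν p) (ν p) ≠ 0) : ContDiffAt ℝ 2 ρ p := by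
  let f : E × ℝ → ℝ := fun x => g (x.1 + x.2 • ν x.1) - h x.1
  have hν' : ContDiffAt ℝ 2 (fun x : E × ℝ => ν x.1) (p, ρ p) :=
    ContDiffAt.comp (p, ρ p) (f := Prod.fst) hν contDiffAt_fst
  have hf : ContDiffAt ℝ 2 f (p, ρ p) := by
    refine ContDiffAt.sub ?_ (hh.contDiffAt.comp _ contDiffAt_fst)
    exact hg.contDiffAt.comp _ (contDiffAt_fst.add (contDiffAt_snd.smul hν'))
  have hpN : p ∈ N := mem_of_mem_nhds hN
  have hderiv : fderiv ℝ f (p, ρ p) (0, 1) = fderiv ℝ g (p + ρ p • ν p) (ν p) := by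
    have h1 : HasFDerivAt f (fderiv ℝ f (p, ρ p)) (p, ρ p) :=
      (hf.differentiableAt two_ne_zero).hasFDerivAt
    have h2 : HasDerivAt (fun t : ℝ => (p, t)) ((0 : E), (1 : ℝ)) (ρ p) :=
      (hasDerivAt_const _ _).prodMk (hasDerivAt_id _)
    have h3 := h1.comp_hasDerivAt (ρ p) h2
    have h4 : HasDerivAt (fun t : ℝ => p + t • ν p) (ν p) (ρ p) := by
      simpa using ((hasDerivAt_id (ρ p)).smul_const (ν p)).const_add p
    have h5 := (((hg.differentiable two_ne_zero)
      (p + ρ p • ν p)).hasFDerivAt.comp_hasDerivAt (ρ p) h4).sub_const (h p)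
    exact h3.unique h5
  -- The partial derivative in `t` is multiplication by the nonzero slope of `g` along the normal,
  -- as the implicit function theorem requires.
  have hinv : (fderiv ℝ f (p, ρ p) ∘L .inr ℝ E ℝ).IsInvertible := by
    refine ⟨ContinuousLinearEquiv.unitsEquivAut ℝ (Units.mk0 _ (hderiv ▸ hA)), ?_⟩
    ext
    simp
  have hfu : f (p, ρ p) = 0 := sub_eq_zero.2 (hsol p hpN)
  set φ := hf.implicitFunction two_ne_zero hinv
  have hφ : ContDiffAt ℝ 2 φ p := hf.contDiffAt_implicitFunction two_ne_zero hinv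
  have hφp : φ p = ρ p := hf.implicitFunction_apply_self two_ne_zero hinv
  have hev : ∀ᶠ q in 𝓝 p, f (q, φ q) = f (p, ρ p) :=
    hf.eventually_apply_implicitFunction two_ne_zero hinv
  have hsmall : ∀ᶠ q in 𝓝 p, |φ q| < τ :=
    (hφ.continuousAt.abs).eventually_lt_const (by simpa only [hφp] using hρ)
  -- The implicit function stays below `τ` near `p`, so uniqueness identifies it with `ρ`, about
  -- whose continuity nothing was assumed.
  refine hφ.congr_of_eventuallyEq ?_
  filter_upwards [hev, hsmall, hN] with q h1 h2 h3
  exact (huniq q h3 (φ q) h2 (sub_eq_zero.1 (h1.trans hfu))).symm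

section Derivatives

variable {g h ρ : E → ℝ} {ν : E → E} {p : E}

lemma hasFDerivAt_normalShift (hρ : DifferentiableAt ℝ ρ p) (hν : DifferentiableAt ℝ ν p) :
    HasFDerivAt (fun q => q + ρ q • ν q)
      (.id ℝ E + (ρ p • fderiv ℝ ν p + (fderiv ℝ ρ p).smulRight (ν p))) p :=
  (hasFDerivAt_id p).add (hρ.hasFDerivAt.smul hν.hasFDerivAt)

/-- Differentiating `g (q + ρ q • ν q) = h q` produces one term containing `Dρ`, multiplied by the
slope of `g` along `ν`; the identity isolates it. -/
lemma smul_fderiv_graph_eq (hg : ContDiff ℝ 2 g) (hρ : DifferentiableAt ℝ ρ p)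
    (hν : DifferentiableAt ℝ ν p) (hsol : ∀ᶠ q in 𝓝 p, g (q + ρ q • ν q) = h q) :
    fderiv ℝ g (p + ρ p • ν p) (ν p) • fderiv ℝ ρ p =
      fderiv ℝ h p - fderiv ℝ g (p + ρ p • ν p)
        - ρ p • (fderiv ℝ g (p + ρ p • ν p) ∘L fderiv ℝ ν p) := by
  have h1 := ((hg.differentiable two_ne_zero) (p + ρ p • ν p)).hasFDerivAt.comp p
    (hasFDerivAt_normalShift hρ hν)
  have h2 : fderiv ℝ h p = _ := (h1.congr_of_eventuallyEq
    (hsol.mono fun q hq => hq.symm)).fderiv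
  rw [h2]
  ext w
  simp
  ring

lemma norm_normalShift_fderiv_sub_id_le {K : ℝ} (hK : ‖fderiv ℝ ν p‖ ≤ K) (hν1 : ‖ν p‖ = 1) :
    ‖ρ p • fderiv ℝ ν p + (fderiv ℝ ρ p).smulRight (ν p)‖ ≤ |ρ p| * K + ‖fderiv ℝ ρ p‖ := by
  refine (norm_add_le _ _).trans (add_le_add ?_ ?_)
  · rw [norm_smul, Real.norm_eq_abs]; gcongr
  · rw [ContinuousLinearMap.norm_smulRight_apply, hν1, mul_one]

lemma norm_fderiv_graph_le {M K c η : ℝ} (hg : ContDiff ℝ 2 g) (hρ : DifferentiableAt ℝ ρ p)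
    (hν : DifferentiableAt ℝ ν p) (hsol : ∀ᶠ q in 𝓝 p, g (q + ρ q • ν q) = h q)
    (hM1 : ∀ x, ‖fderiv ℝ g x‖ ≤ M) (hM2 : ∀ x, ‖fderiv ℝ (fderiv ℝ g) x‖ ≤ M)
    (hK : ‖fderiv ℝ ν p‖ ≤ K) (hν1 : ‖ν p‖ = 1) (hη : ‖fderiv ℝ h p - fderiv ℝ g p‖ ≤ η)
    (hA : c ≤ fderiv ℝ g (p + ρ p • ν p) (ν p)) :
    c * ‖fderiv ℝ ρ p‖ ≤ η + M * |ρ p| + |ρ p| * (M * K) := by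
  have hM0 : 0 ≤ M := (norm_nonneg _).trans (hM1 0)
  have h1 := smul_fderiv_graph_eq hg hρ hν hsol
  have h2 : ‖fderiv ℝ g (p + ρ p • ν p) - fderiv ℝ g p‖ ≤ M * |ρ p| := by
    have := convex_univ.norm_image_sub_le_of_norm_fderiv_le (𝕜 := ℝ) (f := fderiv ℝ g) (C := M)
      (fun y _ => ((hg.fderiv_right (m := 1) (by norm_num)).differentiable one_ne_zero) y)
      (fun y _ => hM2 y) (mem_univ p) (mem_univ (p + ρ p • ν p))
    simpa [norm_smul, hν1] using this
  calc c * ‖fderiv ℝ ρ p‖ ≤ ‖fderiv ℝ g (p + ρ p • ν p) (ν p) • fderiv ℝ ρ p‖ := by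
        rw [norm_smul, Real.norm_eq_abs]; gcongr; exact hA.trans (le_abs_self _)
    _ = ‖(fderiv ℝ h p - fderiv ℝ g p) - (fderiv ℝ g (p + ρ p • ν p) - fderiv ℝ g p)
        - ρ p • (fderiv ℝ g (p + ρ p • ν p) ∘L fderiv ℝ ν p)‖ := by rw [h1]; congr 1; abel
    _ ≤ η + M * |ρ p| + |ρ p| * (M * K) := by
        refine (norm_sub_le _ _).trans (add_le_add ((norm_sub_le _ _).trans (add_le_add hη h2)) ?_)
        rw [norm_smul, Real.norm_eq_abs]
        gcongr
        refine (ContinuousLinearMap.opNorm_comp_le _ _).trans ?_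
        gcongr
        exact hM1 _

/-- This differentiates `smul_fderiv_graph_eq` once more. Each remaining term carries a small
factor: `D²h - D²g`, the oscillation of `D²g` between `p` and its image, the deviation of the
shift's derivative from the identity, `ρ`, or `Dρ`. The second derivative of `ν` occurs only
multiplied by `ρ`, which is what `R` records. -/
lemma norm_fderiv_fderiv_graph_le {M K c η e r R : ℝ} (hg : ContDiff ℝ 2 g) (hh : ContDiff ℝ 2 h)
    (hρ : ContDiffAt ℝ 2 ρ p)
    (hν : ContDiffAt ℝ 2 ν p) (hsol : ∀ᶠ q in 𝓝 p, g (q + ρ q • ν q) = h q)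
    (hM1 : ∀ x, ‖fderiv ℝ g x‖ ≤ M) (hM2 : ∀ x, ‖fderiv ℝ (fderiv ℝ g) x‖ ≤ M)
    (hK : ‖fderiv ℝ ν p‖ ≤ K) (hν1 : ‖ν p‖ = 1)
    (hη : ‖fderiv ℝ (fderiv ℝ h) p - fderiv ℝ (fderiv ℝ g) p‖ ≤ η)
    (hA : c ≤ fderiv ℝ g (p + ρ p • ν p) (ν p))
    (he : ‖fderiv ℝ (fderiv ℝ g) (p + ρ p • ν p) - fderiv ℝ (fderiv ℝ g) p‖ ≤ e)
    (hr : |ρ p| * K + ‖fderiv ℝ ρ p‖ ≤ r) (hr1 : r ≤ 1)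
    (hR : |ρ p| * ‖fderiv ℝ (fderiv ℝ ν) p‖ ≤ R) :
    c * ‖fderiv ℝ (fderiv ℝ ρ) p‖ ≤ η + e + M * r + ‖fderiv ℝ ρ p‖ * (M * K)
      + (M * R + |ρ p| * (2 * M * K)) + (M * K + 2 * M) * ‖fderiv ℝ ρ p‖ := by
  have hM0 : 0 ≤ M := (norm_nonneg _).trans (hM1 0)
  have hK0 : 0 ≤ K := (norm_nonneg _).trans hK
  have hR0 : 0 ≤ R := le_trans (by positivity) hR
  have he0 : 0 ≤ e := (norm_nonneg _).trans he
  have hη0 : 0 ≤ η := (norm_nonneg _).trans hη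
  have hr0 : 0 ≤ r := le_trans (by positivity) hr
  set y := p + ρ p • ν p
  set Dy : E →L[ℝ] E := .id ℝ E + (ρ p • fderiv ℝ ν p + (fderiv ℝ ρ p).smulRight (ν p)) with hDy
  have hgD : ContDiff ℝ 1 (fderiv ℝ g) := hg.fderiv_right (by norm_num)
  have hρd := hρ.differentiableAt two_ne_zero
  have hνd := hν.differentiableAt two_ne_zero
  have hyd : HasFDerivAt (fun q => q + ρ q • ν q) Dy p := hasFDerivAt_normalShift hρd hνd
  have hDy1 : ‖Dy - .id ℝ E‖ ≤ r := by
    rw [hDy, add_sub_cancel_left]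
    exact (norm_normalShift_fderiv_sub_id_le hK hν1).trans hr
  have hDy2 : ‖Dy‖ ≤ 2 := by
    have h1 : ‖Dy‖ ≤ ‖Dy - .id ℝ E‖ + ‖ContinuousLinearMap.id ℝ E‖ := by
      simpa using norm_add_le (Dy - .id ℝ E) (.id ℝ E)
    linarith [ContinuousLinearMap.norm_id_le (𝕜 := ℝ) (E := E)]
  have hG : HasFDerivAt (fun q => fderiv ℝ g (q + ρ q • ν q)) (fderiv ℝ (fderiv ℝ g) y ∘L Dy) p :=
    HasFDerivAt.comp p ((hgD.differentiable one_ne_zero) y).hasFDerivAt hyd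
  have hνD : HasFDerivAt (fderiv ℝ ν) (fderiv ℝ (fderiv ℝ ν) p) p :=
    ((hν.fderiv_right (m := 1) (by norm_num)).differentiableAt one_ne_zero).hasFDerivAt
  have hρD : HasFDerivAt (fderiv ℝ ρ) (fderiv ℝ (fderiv ℝ ρ) p) p :=
    ((hρ.fderiv_right (m := 1) (by norm_num)).differentiableAt one_ne_zero).hasFDerivAt
  have hhD : HasFDerivAt (fderiv ℝ h) (fderiv ℝ (fderiv ℝ h) p) p :=
    (((hh.fderiv_right (m := 1) (by norm_num)).differentiable one_ne_zero) p).hasFDerivAt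
  have hlhs := (hG.clm_apply hνd.hasFDerivAt).smul hρD
  have hrhs := (hhD.sub hG).sub (hρd.hasFDerivAt.smul (hG.clm_comp hνD))
  -- The first-order identity holds on a neighbourhood of `p`, so its two sides have the same
  -- derivative there.
  have hev : (fun q => fderiv ℝ g (q + ρ q • ν q) (ν q) • fderiv ℝ ρ q) =ᶠ[𝓝 p]
      (fun q => fderiv ℝ h q - fderiv ℝ g (q + ρ q • ν q)
        - ρ q • (fderiv ℝ g (q + ρ q • ν q) ∘L fderiv ℝ ν q)) := by
    have h1 := hρ.eventually (by simp)
    have h2 := hν.eventually (by simp)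
    filter_upwards [h1, h2, hsol.eventually_nhds] with q a1 a2 a3
    exact smul_fderiv_graph_eq hg (a1.differentiableAt two_ne_zero)
      (a2.differentiableAt two_ne_zero) a3
  have heq := hlhs.unique (hrhs.congr_of_eventuallyEq hev)
  have hGw : ∀ w, ‖(fderiv ℝ (fderiv ℝ g) y) (Dy w)‖ ≤ 2 * M * ‖w‖ := fun w => by
    calc _ ≤ ‖fderiv ℝ (fderiv ℝ g) y‖ * ‖Dy w‖ := ContinuousLinearMap.le_opNorm _ _
      _ ≤ M * (2 * ‖w‖) := by
        gcongr
        · exact hM2 y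
        · exact (Dy.le_opNorm w).trans (by gcongr)
      _ = _ := by ring
  have hmain : ∀ w, ‖fderiv ℝ g y (ν p) • fderiv ℝ (fderiv ℝ ρ) p w‖ ≤
      (η + e + M * r + ‖fderiv ℝ ρ p‖ * (M * K)
      + (M * R + |ρ p| * (2 * M * K)) + (M * K + 2 * M) * ‖fderiv ℝ ρ p‖) * ‖w‖ := fun w => by
    have h1 := congrArg (fun T => T w) heq
    simp only [_root_.add_apply, _root_.sub_apply,
      _root_.smul_apply, ContinuousLinearMap.smulRight_apply,
      ContinuousLinearMap.comp_apply, ContinuousLinearMap.flip_apply,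
      ContinuousLinearMap.compL_apply] at h1
    have h2 := eq_sub_of_add_eq h1
    change fderiv ℝ g y (ν p) • fderiv ℝ (fderiv ℝ ρ) p w = _ at h2
    rw [h2]
    have t1 : ‖fderiv ℝ (fderiv ℝ h) p w - fderiv ℝ (fderiv ℝ g) y (Dy w)‖
        ≤ (η + e + M * r) * ‖w‖ := by
      have : fderiv ℝ (fderiv ℝ h) p w - fderiv ℝ (fderiv ℝ g) y (Dy w) =
        (fderiv ℝ (fderiv ℝ h) p - fderiv ℝ (fderiv ℝ g) p) w
        - (fderiv ℝ (fderiv ℝ g) y - fderiv ℝ (fderiv ℝ g) p) w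
        - fderiv ℝ (fderiv ℝ g) y ((Dy - .id ℝ E) w) := by
          simp only [_root_.sub_apply, map_sub, ContinuousLinearMap.id_apply]; abel
      rw [this, add_mul, add_mul]
      refine (norm_sub_le _ _).trans (add_le_add ((norm_sub_le _ _).trans (add_le_add ?_ ?_)) ?_)
      · exact ContinuousLinearMap.le_of_opNorm_le _ hη w
      · exact ContinuousLinearMap.le_of_opNorm_le _ he w
      · rw [mul_assoc]
        refine (ContinuousLinearMap.le_opNorm _ _).trans ?_
        gcongr
        · exact hM2 y
        · exact ContinuousLinearMap.le_of_opNorm_le _ hDy1 w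
    have t2 : ‖fderiv ℝ g y ∘L fderiv ℝ ν p‖ ≤ M * K :=
      (ContinuousLinearMap.opNorm_comp_le _ _).trans (by gcongr; exact hM1 y)
    have hρw : ‖fderiv ℝ ρ p w‖ ≤ ‖fderiv ℝ ρ p‖ * ‖w‖ := ContinuousLinearMap.le_opNorm _ _
    have t3 : ‖ρ p • (fderiv ℝ g y ∘L fderiv ℝ (fderiv ℝ ν) p w
        + fderiv ℝ (fderiv ℝ g) y (Dy w) ∘L fderiv ℝ ν p)‖
        ≤ (M * R + |ρ p| * (2 * M * K)) * ‖w‖ := by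
      rw [norm_smul, Real.norm_eq_abs]
      calc _ ≤ |ρ p| * (M * (‖fderiv ℝ (fderiv ℝ ν) p‖ * ‖w‖) + 2 * M * ‖w‖ * K) := by
            gcongr
            refine (norm_add_le _ _).trans (add_le_add ?_ ?_)
            · refine (ContinuousLinearMap.opNorm_comp_le _ _).trans ?_
              gcongr
              · exact hM1 y
              · exact ContinuousLinearMap.le_opNorm _ _
            · refine (ContinuousLinearMap.opNorm_comp_le _ _).trans ?_
              gcongr
              exact hGw w
        _ = M * ‖w‖ * (|ρ p| * ‖fderiv ℝ (fderiv ℝ ν) p‖) + |ρ p| * (2 * M * K) * ‖w‖ := by ring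
        _ ≤ M * ‖w‖ * R + |ρ p| * (2 * M * K) * ‖w‖ := by gcongr
        _ = _ := by ring
    have t4 : ‖fderiv ℝ ρ p w • (fderiv ℝ g y ∘L fderiv ℝ ν p)‖
        ≤ ‖fderiv ℝ ρ p‖ * (M * K) * ‖w‖ := by
      rw [norm_smul]
      calc _ ≤ (‖fderiv ℝ ρ p‖ * ‖w‖) * (M * K) := by gcongr
        _ = _ := by ring
    have t5 : ‖(fderiv ℝ g y (fderiv ℝ ν p w) + fderiv ℝ (fderiv ℝ g) y (Dy w) (ν p))
        • fderiv ℝ ρ p‖ ≤ (M * K + 2 * M) * ‖fderiv ℝ ρ p‖ * ‖w‖ := by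
      rw [norm_smul]
      have a1 : ‖fderiv ℝ g y (fderiv ℝ ν p w)‖ ≤ M * K * ‖w‖ :=
        ContinuousLinearMap.le_of_opNorm_le _ t2 w
      have a2 : ‖fderiv ℝ (fderiv ℝ g) y (Dy w) (ν p)‖ ≤ 2 * M * ‖w‖ := by
        have := ContinuousLinearMap.le_of_opNorm_le _ (hGw w) (ν p)
        rwa [hν1, mul_one] at this
      calc _ ≤ (M * K * ‖w‖ + 2 * M * ‖w‖) * ‖fderiv ℝ ρ p‖ := by
            gcongr
            exact (norm_add_le _ _).trans (add_le_add a1 a2)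
        _ = _ := by ring
    refine ((norm_sub_le _ _).trans (add_le_add ((norm_sub_le _ _).trans
      (add_le_add t1 ((norm_add_le _ _).trans (add_le_add t3 t4)))) t5)).trans (le_of_eq ?_)
    ring
  rcases le_or_gt c 0 with hc | hc
  · exact (mul_nonpos_of_nonpos_of_nonneg hc (norm_nonneg _)).trans (by positivity)
  rw [← le_div_iff₀' hc]
  refine ContinuousLinearMap.opNorm_le_bound _ (by positivity) fun w => ?_
  rw [div_mul_eq_mul_div, le_div_iff₀' hc]
  refine le_trans ?_ (hmain w)
  rw [norm_smul, Real.norm_eq_abs]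
  gcongr
  exact hA.trans (le_abs_self _)

end Derivatives

/-- `h` is an approximation of `g` of order two, whose third derivatives are under control. -/
def IsApprox (η : ℝ) (g h : E → ℝ) : Prop :=
  ∀ x, |h x - g x| ≤ η ∧ ‖fderiv ℝ h x - fderiv ℝ g x‖ ≤ η ∧
    ‖fderiv ℝ (fderiv ℝ h) x - fderiv ℝ (fderiv ℝ g) x‖ ≤ η ∧
    |h x - g x| * ‖fderiv ℝ (fderiv ℝ (fderiv ℝ h)) x‖ ≤ η

/-- For every good approximation `h` of `g`, the level sets of `g` are normal graphs over those of
`h`, with a graph function that is small of order two in the ambient space. -/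
theorem exists_graph_function [FiniteDimensional ℝ E] {g : E → ℝ} (hg : ContDiff ℝ 2 g) {M b : ℝ}
    (hM1 : ∀ x, ‖fderiv ℝ g x‖ ≤ M) (hM2 : ∀ x, ‖fderiv ℝ (fderiv ℝ g) x‖ ≤ M)
    (huc : UniformContinuous (fderiv ℝ (fderiv ℝ g))) (hb : 0 < b) {N : Set E} (hN : IsOpen N)
    (hNb : ∀ x ∈ N, b ≤ ‖fderiv ℝ g x‖) :
    ∃ K, 0 ≤ K ∧ ∀ ζ > 0, ∃ η > 0, ∀ h : E → ℝ, ContDiff ℝ ω h → IsApprox η g h →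
      ∃ ρ : E → ℝ, ∀ p ∈ N, ContDiffAt ℝ 2 ρ p ∧ fderiv ℝ h p ≠ 0 ∧
        g (p + ρ p • unitNormal h p) = h p ∧ ‖fderiv ℝ (unitNormal h) p‖ ≤ K ∧
        |ρ p| ≤ ζ ∧ ‖fderiv ℝ ρ p‖ ≤ ζ ∧ ‖fderiv ℝ (fderiv ℝ ρ) p‖ ≤ ζ := by
  have hM0 : 0 ≤ M := (norm_nonneg _).trans (hM1 0)
  obtain ⟨K, hK0, hK⟩ := exists_bound_fderiv_unitNormal (E := E) (half_pos hb)
    (M := M + 1) (by positivity)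
  refine ⟨K, hK0, fun ζ hζ => ?_⟩
  set c := b / 2 with hc
  have hc0 : 0 < c := half_pos hb
  -- With `e` the size of the approximation error, the aim is `|ρ| ≤ q₀ e`, `‖Dρ‖ ≤ q₁ e` and `‖D²ρ‖
  -- ≤ q₂ e`; the constants are read off from the two derivative estimates above.
  set q₀ := 1 / c
  set q₁ := (1 + M * q₀ + q₀ * (M * K)) / c
  set q₂ := (1 + 1 + M * (q₀ * K + q₁) + q₁ * (M * K)
    + (M * (K * (q₀ + q₀)) + q₀ * (2 * M * K)) + (M * K + 2 * M) * q₁) / c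
  have hq₀ : 0 < q₀ := by positivity
  have hq₁ : 0 < q₁ := by positivity
  have hq₂ : 0 < q₂ := by positivity
  -- Since `M τ ≤ b / 4` and `e < b / 8`, the slope of `g` along the normal of `h` is at least `b -
  -- 2 e - M τ ≥ b / 2 = c` for `|t| ≤ τ`.
  set τ := b / (4 * (M + 1))
  have hτ : 0 < τ := by positivity
  obtain ⟨e, he0, heb, heτ, her, heζ0, heζ1, heζ2⟩ : ∃ e : ℝ, 0 < e ∧ e < min 1 (b / 8) ∧
      q₀ * e < τ ∧ (q₀ * K + q₁) * e < 1 ∧ q₀ * e < ζ ∧ q₁ * e < ζ ∧ q₂ * e < ζ := by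
    have aux : ∀ q a : ℝ, 0 < a → ∀ᶠ e in 𝓝[>] (0 : ℝ), q * e < a := fun q a ha => by
      have : Tendsto (fun e : ℝ => q * e) (𝓝[>] 0) (𝓝 (q * 0)) :=
        ((by fun_prop : Continuous fun e : ℝ => q * e).tendsto 0).mono_left nhdsWithin_le_nhds
      exact this.eventually_lt_const (by simpa using ha)
    obtain ⟨e, he⟩ := ((aux 1 (min 1 (b / 8)) (by positivity)).and ((aux q₀ τ hτ).and
      ((aux (q₀ * K + q₁) 1 one_pos).and ((aux q₀ ζ hζ).and ((aux q₁ ζ hζ).and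
      ((aux q₂ ζ hζ).and self_mem_nhdsWithin)))))).exists
    exact ⟨e, he.2.2.2.2.2.2, by simpa using he.1, he.2.1, he.2.2.1, he.2.2.2.1, he.2.2.2.2.1,
      he.2.2.2.2.2.1⟩
  obtain ⟨δ, hδ, hmod⟩ := Metric.uniformContinuous_iff.1 huc e he0
  -- The second entry forces `|ρ| ≤ |h - g| / c ≤ δ / 2`, so that uniform continuity of `D²g`
  -- applies between `p` and its image.
  refine ⟨min e (c * δ / 2), by positivity, fun h hh happ => ?_⟩
  have he1 : e < 1 := heb.trans_le (min_le_left _ _)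
  have he8 : e < b / 8 := heb.trans_le (min_le_right _ _)
  have hap0 : ∀ x, |h x - g x| ≤ e := fun x => (happ x).1.trans (min_le_left _ _)
  have hap0' : ∀ x, |h x - g x| ≤ c * δ / 2 := fun x => (happ x).1.trans (min_le_right _ _)
  have hap1 : ∀ x, ‖fderiv ℝ h x - fderiv ℝ g x‖ ≤ e :=
    fun x => (happ x).2.1.trans (min_le_left _ _)
  have hap2 : ∀ x, ‖fderiv ℝ (fderiv ℝ h) x - fderiv ℝ (fderiv ℝ g) x‖ ≤ e :=
    fun x => (happ x).2.2.1.trans (min_le_left _ _)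
  have hap3 : ∀ x, |h x - g x| * ‖fderiv ℝ (fderiv ℝ (fderiv ℝ h)) x‖ ≤ e :=
    fun x => (happ x).2.2.2.trans (min_le_left _ _)
  have hDh : ∀ p ∈ N, b - e ≤ ‖fderiv ℝ h p‖ := fun p hp => by
    have := norm_le_norm_add_norm_sub (fderiv ℝ h p) (fderiv ℝ g p)
    linarith [hNb p hp, hap1 p]
  have hDh0 : ∀ p ∈ N, fderiv ℝ h p ≠ 0 := fun p hp =>
    norm_ne_zero_iff.1 (by linarith [hDh p hp])
  have hν1 : ∀ p ∈ N, ‖unitNormal h p‖ = 1 := fun p hp => norm_dualDirection (hDh0 p hp)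
  have hνC : ∀ p ∈ N, ContDiffAt ℝ 2 (unitNormal h) p := fun p hp =>
    contDiffAt_unitNormal hh (hDh0 p hp) (by simp)
  have hlip : ∀ x y, ‖fderiv ℝ g y - fderiv ℝ g x‖ ≤ M * ‖y - x‖ := fun x y =>
    convex_univ.norm_image_sub_le_of_norm_fderiv_le (𝕜 := ℝ)
      (fun y _ => ((hg.fderiv_right (m := 1) (by norm_num)).differentiable one_ne_zero) y)
      (fun y _ => hM2 y) (mem_univ x) (mem_univ y)
  -- the slope of `g` along the normal lines
  have hslope : ∀ p ∈ N, ∀ t ∈ Icc (-τ) τ,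
      c ≤ fderiv ℝ g (p + t • unitNormal h p) (unitNormal h p) := fun p hp t ht => by
    have h1 := apply_dualDirection (fderiv ℝ h p)
    change fderiv ℝ h p (unitNormal h p) = _ at h1
    have h2 : |(fderiv ℝ h p - fderiv ℝ g p) (unitNormal h p)| ≤ e := by
      have := ContinuousLinearMap.le_of_opNorm_le _ (hap1 p) (unitNormal h p)
      rwa [hν1 p hp, mul_one] at this
    have h3 : |(fderiv ℝ g (p + t • unitNormal h p) - fderiv ℝ g p) (unitNormal h p)|
        ≤ M * τ := by
      have h4 := (hlip p (p + t • unitNormal h p)).trans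
        (mul_le_mul_of_nonneg_left (b := ‖p + t • unitNormal h p - p‖) (c := τ) (by
          rw [add_sub_cancel_left, norm_smul, hν1 p hp, mul_one]; exact abs_le.2 ht) hM0)
      have := ContinuousLinearMap.le_of_opNorm_le _ h4 (unitNormal h p)
      rwa [hν1 p hp, mul_one] at this
    have h5 : M * τ ≤ b / 4 := by
      have : (M + 1) * τ = b / 4 := by simp only [τ]; field_simp
      linarith
    rw [_root_.sub_apply, abs_le] at h2 h3
    linarith [hDh p hp, h2.2, h3.1]
  have hline : ∀ p t, HasDerivAt (fun t : ℝ => g (p + t • unitNormal h p) - h p)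
      (fderiv ℝ g (p + t • unitNormal h p) (unitNormal h p)) t := fun p t => by
    have h4 : HasDerivAt (fun t : ℝ => p + t • unitNormal h p) (unitNormal h p) t := by
      simpa using ((hasDerivAt_id t).smul_const (unitNormal h p)).const_add p
    exact (((hg.differentiable two_ne_zero)
      (p + t • unitNormal h p)).hasFDerivAt.comp_hasDerivAt t h4).sub_const (h p)
  have hex : ∀ p, ∃ t : ℝ, p ∈ N → g (p + t • unitNormal h p) - h p = 0 ∧
      |t| ≤ |h p - g p| / c := fun p => by
    by_cases hp : p ∈ N
    · have h0 : |g (p + (0 : ℝ) • unitNormal h p) - h p| = |h p - g p| := by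
        rw [zero_smul, add_zero, abs_sub_comm]
      obtain ⟨t, ht⟩ := exists_zero_of_le_hasDerivAt hc0 (hline p) (hslope p hp) (by
        rw [h0, div_le_iff₀ hc0]
        have : q₀ * e * c = e := by simp only [q₀]; field_simp
        nlinarith [hap0 p])
      exact ⟨t, fun _ => by rwa [h0] at ht⟩
    · exact ⟨0, fun h => absurd h hp⟩
  choose ρ hρ using hex
  have hρq : ∀ p ∈ N, |ρ p| ≤ q₀ * |h p - g p| := fun p hp => by
    refine (hρ p hp).2.trans (le_of_eq ?_)
    simp only [q₀]; ring
  have hρe : ∀ p ∈ N, |ρ p| ≤ q₀ * e := fun p hp =>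
    (hρq p hp).trans (by gcongr; exact hap0 p)
  have hρτ : ∀ p ∈ N, |ρ p| < τ := fun p hp => (hρe p hp).trans_lt heτ
  have hsol : ∀ p ∈ N, g (p + ρ p • unitNormal h p) = h p := fun p hp =>
    sub_eq_zero.1 (hρ p hp).1
  have hA : ∀ p ∈ N, c ≤ fderiv ℝ g (p + ρ p • unitNormal h p) (unitNormal h p) := fun p hp =>
    hslope p hp _ (abs_le.1 (hρτ p hp).le)
  have hh2 : ContDiff ℝ 2 h := hh.of_le (by simp)
  have hρC : ∀ p ∈ N, ContDiffAt ℝ 2 ρ p := fun p hp =>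
    contDiffAt_of_unique_solution (hN.mem_nhds hp) hg hh2 (hνC p hp) (hρτ p hp) hsol
      (fun q hq t ht hqt => eq_of_le_hasDerivAt hc0 (hline q) (hslope q hq) ht.le (hρτ q hq).le
        (by rw [sub_eq_zero.2 hqt, (hρ q hq).1]))
      (hc0.trans_le (hA p hp)).ne'
  refine ⟨ρ, fun p hp => ?_⟩
  have hsolev : ∀ᶠ q in 𝓝 p, g (q + ρ q • unitNormal h q) = h q :=
    mem_of_superset (hN.mem_nhds hp) hsol
  have hn : ‖fderiv ℝ h p‖ ≤ M + 1 := by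
    have := norm_le_norm_add_norm_sub (fderiv ℝ g p) (fderiv ℝ h p)
    rw [norm_sub_rev] at this
    linarith [hM1 p, hap1 p]
  have hn2 : ‖fderiv ℝ (fderiv ℝ h) p‖ ≤ M + 1 := by
    have := norm_le_norm_add_norm_sub (fderiv ℝ (fderiv ℝ g) p) (fderiv ℝ (fderiv ℝ h) p)
    rw [norm_sub_rev] at this
    linarith [hM2 p, hap2 p]
  obtain ⟨hK1, hK2⟩ := hK h hh p (by linarith [hDh p hp]) hn hn2
  have hρd := (hρC p hp).differentiableAt two_ne_zero
  have hνd := (hνC p hp).differentiableAt two_ne_zero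
  have hD1 : ‖fderiv ℝ ρ p‖ ≤ q₁ * e := by
    have h1 := norm_fderiv_graph_le hg hρd hνd hsolev hM1 hM2 hK1 (hν1 p hp) (hap1 p) (hA p hp)
    have h2 : q₁ * e = (e + M * (q₀ * e) + q₀ * e * (M * K)) / c := by simp only [q₁]; ring
    rw [h2, le_div_iff₀' hc0]
    refine h1.trans ?_
    gcongr <;> exact hρe p hp
  -- Here the loss of a derivative is compensated: `|ρ| ≤ q₀ |h - g|` turns the product bound of
  -- `IsApprox` into smallness of `ρ D²ν`.
  have hR : |ρ p| * ‖fderiv ℝ (fderiv ℝ (unitNormal h)) p‖ ≤ K * (q₀ + q₀) * e := by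
    calc _ ≤ |ρ p| * (K * (1 + ‖fderiv ℝ (fderiv ℝ (fderiv ℝ h)) p‖)) := by gcongr
      _ = K * (|ρ p| + |ρ p| * ‖fderiv ℝ (fderiv ℝ (fderiv ℝ h)) p‖) := by ring
      _ ≤ K * (q₀ * e + q₀ * |h p - g p| * ‖fderiv ℝ (fderiv ℝ (fderiv ℝ h)) p‖) := by
        gcongr
        · exact hρe p hp
        · exact hρq p hp
      _ = K * (q₀ * e + q₀ * (|h p - g p| * ‖fderiv ℝ (fderiv ℝ (fderiv ℝ h)) p‖)) := by ring
      _ ≤ K * (q₀ * e + q₀ * e) := by gcongr; exact hap3 p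
      _ = _ := by ring
  have hD2 : ‖fderiv ℝ (fderiv ℝ ρ) p‖ ≤ q₂ * e := by
    have hee : ‖fderiv ℝ (fderiv ℝ g) (p + ρ p • unitNormal h p) - fderiv ℝ (fderiv ℝ g) p‖
        ≤ e := by
      have := hmod (a := p + ρ p • unitNormal h p) (b := p) (by
        rw [dist_eq_norm, add_sub_cancel_left, norm_smul, hν1 p hp, mul_one]
        refine ((hρ p hp).2.trans (div_le_div_of_nonneg_right (hap0' p) hc0.le)).trans_lt ?_
        rw [div_lt_iff₀ hc0]
        nlinarith)
      rw [dist_eq_norm] at this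
      exact this.le
    have h1 := norm_fderiv_fderiv_graph_le hg hh2 (hρC p hp) (hνC p hp) hsolev hM1 hM2 hK1
      (hν1 p hp) (hap2 p) (hA p hp) hee (r := (q₀ * K + q₁) * e) (by
        rw [add_mul]
        refine add_le_add ?_ hD1
        calc |ρ p| * K ≤ q₀ * e * K := by gcongr; exact hρe p hp
          _ = _ := by ring) her.le hR
    have h2 : q₂ * e = (e + e + M * ((q₀ * K + q₁) * e) + q₁ * e * (M * K)
      + (M * (K * (q₀ + q₀) * e) + q₀ * e * (2 * M * K)) + (M * K + 2 * M) * (q₁ * e)) / c := by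
      simp only [q₂]; ring
    rw [h2, le_div_iff₀' hc0]
    refine h1.trans ?_
    gcongr
    exact hρe p hp
  exact ⟨hρC p hp, hDh0 p hp, hsol p hp, hK1, (hρe p hp).trans heζ0.le, hD1.trans heζ1.le,
    hD2.trans heζ2.le⟩

end GraphFunction

/-! ### A global C² defining function for the domain. -/

section DefiningFunction

variable {m : ℕ} {k : WithTop ℕ∞} {S Ω : Set (Amb m)}

lemma IsEnclosingHypersurface.subset_closure (hS : IsEnclosingHypersurface k S Ω) :
    S ⊆ closure Ω := hS.frontier_domain ▸ frontier_subset_closure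

lemma IsEnclosingHypersurface.notMem_domain (hS : IsEnclosingHypersurface k S Ω) {x : Amb m}
    (hx : x ∈ S) : x ∉ Ω := fun h => by
  rw [← hS.frontier_domain, frontier, hS.isOpen_domain.interior_eq] at hx
  exact hx.2 h

lemma IsEnclosingHypersurface.notMem_closure (hS : IsEnclosingHypersurface k S Ω) {x : Amb m}
    (hx : x ∉ S) (hx' : x ∉ Ω) : x ∉ closure Ω := fun h => by
  rw [← hS.frontier_domain, frontier, hS.isOpen_domain.interior_eq] at hx
  exact hx ⟨h, hx'⟩

/-- Either side of a hypersurface in a flattening chart lies inside or outside. -/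
lemma IsEnclosingHypersurface.side_subset (hS : IsEnclosingHypersurface k S Ω)
    {Φ : OpenPartialHomeomorph (Amb m) (Par m × ℝ)} (hΦ : IsFlatteningChart k S Φ)
    {z : Par m × ℝ} {r : ℝ} (hr : Metric.ball z r ⊆ Φ.target) (s : ℝ) :
    (∀ x ∈ Φ.source, Φ x ∈ Metric.ball z r → 0 < s * (Φ x).2 → x ∈ Ω) ∨
    (∀ x ∈ Φ.source, Φ x ∈ Metric.ball z r → 0 < s * (Φ x).2 → x ∉ closure Ω) := by
  set H : Set (Par m × ℝ) := Metric.ball z r ∩ {y | 0 < s * y.2}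
  have hH : Convex ℝ H := (convex_ball z r).inter
    (convex_halfSpace_gt (f := fun y : Par m × ℝ => s * y.2)
      ⟨fun x y => by simp [mul_add], fun c x => by simp; ring⟩ 0)
  have hT : IsPreconnected (Φ.symm '' H) := hH.isPreconnected.image _
    (Φ.continuousOn_symm.mono fun y hy => hr hy.1)
  have hsub : Φ.symm '' H ⊆ Ω ∪ (closure Ω)ᶜ := by
    rintro _ ⟨y, hy, rfl⟩
    by_cases h : Φ.symm y ∈ Ω
    · exact Or.inl h
    · refine Or.inr (hS.notMem_closure (fun h' => ?_) h)
      rw [hΦ.mem_iff _ (Φ.map_target (hr hy.1)), Φ.right_inv (hr hy.1)] at h'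
      have := hy.2
      simp [h'] at this
  have hmem : ∀ x ∈ Φ.source, Φ x ∈ Metric.ball z r → 0 < s * (Φ x).2 → x ∈ Φ.symm '' H :=
    fun x hx h1 h2 => ⟨Φ x, ⟨h1, h2⟩, Φ.left_inv hx⟩
  rcases hT.subset_or_subset hS.isOpen_domain isClosed_closure.isOpen_compl
    (disjoint_compl_right.mono_left _root_.subset_closure) hsub with h | h
  · exact Or.inl fun x hx h1 h2 => h (hmem x hx h1 h2)
  · exact Or.inr fun x hx h1 h2 => h (hmem x hx h1 h2)

/-- Points of a hypersurface are limits of points on either side. -/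
lemma IsFlatteningChart.frequently_side {Φ : OpenPartialHomeomorph (Amb m) (Par m × ℝ)}
    (hΦ : IsFlatteningChart k S Φ) {q : Amb m} (hq : q ∈ Φ.source) (hqS : q ∈ S) {V : Set (Amb m)}
    (hV : V ∈ 𝓝 q) {s : ℝ} (hs : s ≠ 0) : ∃ x ∈ V, x ∈ Φ.source ∧ 0 < s * (Φ x).2 := by
  have h0 := (hΦ.mem_iff q hq).1 hqS
  have h1 : Tendsto (fun t : ℝ => ((Φ q).1, s * t)) (𝓝[>] 0) (𝓝 (Φ q)) := by
    have hcont : Continuous (fun t : ℝ => ((Φ q).1, s * t)) := by fun_prop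
    have hz : Φ q = ((Φ q).1, s * 0) := by rw [mul_zero, ← h0]
    rw [hz]
    exact (hcont.tendsto 0).mono_left nhdsWithin_le_nhds
  have hc : ∀ᶠ t : ℝ in 𝓝[>] 0, Φ.symm ((Φ q).1, s * t) ∈ V := by
    have h2 := (Φ.continuousAt_symm (Φ.map_source hq)).tendsto
    rw [Φ.left_inv hq] at h2
    exact (h2.comp h1).eventually_mem hV
  have ht : ∀ᶠ t : ℝ in 𝓝[>] 0, ((Φ q).1, s * t) ∈ Φ.target :=
    h1.eventually_mem (Φ.open_target.mem_nhds (Φ.map_source hq))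
  obtain ⟨t, ⟨ht1, ht2⟩, ht3⟩ := ((hc.and ht).and self_mem_nhdsWithin).exists
  refine ⟨_, ht1, Φ.map_target ht2, ?_⟩
  rw [Φ.right_inv ht2]
  have : 0 < t := ht3
  change 0 < s * (s * t)
  rw [← mul_assoc]
  exact mul_pos (mul_self_pos.2 hs) this

lemma exists_ball_subset_target {Φ : OpenPartialHomeomorph (Amb m) (Par m × ℝ)} {p : Amb m}
    (hp : p ∈ Φ.source) : ∃ r > 0, Metric.ball (Φ p) r ⊆ Φ.target ∧
      Φ.source ∩ Φ ⁻¹' Metric.ball (Φ p) r ∈ 𝓝 p := by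
  obtain ⟨r, hr, h⟩ := Metric.isOpen_iff.1 Φ.open_target _ (Φ.map_source hp)
  refine ⟨r, hr, h, (Φ.isOpen_inter_preimage Metric.isOpen_ball).mem_nhds ⟨hp, ?_⟩⟩
  exact Metric.mem_ball_self hr

/-- This excludes a hypersurface with `Ω` on both sides. Near a point of `S` not interior to the
closure, one side of a chart avoids the closure, and nearby points of `S` are limits of that side.
The alternative is therefore locally constant on the connected set `S`. If all of `S` were interior,
the closure of `Ω` would be open and closed, hence the whole space, against boundedness. -/
lemma IsEnclosingHypersurface.notMem_interior_closure (hS : IsEnclosingHypersurface k S Ω)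
    {p : Amb m} (hp : p ∈ S) : p ∉ interior (closure Ω) := by
  have hloc : ∀ x ∈ S, ∀ᶠ y in 𝓝[S] x, x ∉ interior (closure Ω) → y ∉ interior (closure Ω) := by
    intro x hx
    by_cases hxi : x ∈ interior (closure Ω)
    · exact Eventually.of_forall fun y h => absurd hxi h
    obtain ⟨Φ, hxΦ, hΦ⟩ := hS.isHypersurface x hx
    obtain ⟨r, hr, hball, hnhds⟩ := exists_ball_subset_target hxΦ
    obtain ⟨y, ⟨hyΦ, hyr⟩, hy⟩ : ∃ y ∈ Φ.source ∩ Φ ⁻¹' Metric.ball (Φ x) r, y ∉ closure Ω := by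
      by_contra! hcon
      exact hxi (mem_interior_iff_mem_nhds.2 (mem_of_superset hnhds hcon))
    have hy0 : (Φ y).2 ≠ 0 := fun h =>
      hy (hS.subset_closure ((hΦ.mem_iff y hyΦ).2 h))
    have hpos : 0 < (Φ y).2 * (Φ y).2 := mul_self_pos.2 hy0
    have hside : ∀ x' ∈ Φ.source, Φ x' ∈ Metric.ball (Φ x) r → 0 < (Φ y).2 * (Φ x').2 →
        x' ∉ closure Ω := by
      rcases hS.side_subset hΦ hball (Φ y).2 with h | h
      · exact absurd (_root_.subset_closure (h y hyΦ hyr hpos)) hy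
      · exact h
    filter_upwards [self_mem_nhdsWithin, mem_nhdsWithin_of_mem_nhds hnhds] with q hqS hq _ hqi
    obtain ⟨x', hx'V, hx'Φ, hx'⟩ := hΦ.frequently_side hq.1 hqS
      (inter_mem (isOpen_interior.mem_nhds hqi)
        ((Φ.isOpen_inter_preimage Metric.isOpen_ball).mem_nhds hq)) hy0
    exact hside x' hx'Φ hx'V.2.2 hx' (interior_subset hx'V.1)
  have hloc' : ∀ x ∈ S, ∀ᶠ y in 𝓝[S] x, y ∉ interior (closure Ω) → x ∉ interior (closure Ω) := by
    intro x hx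
    by_cases hxi : x ∈ interior (closure Ω)
    · filter_upwards [mem_nhdsWithin_of_mem_nhds (isOpen_interior.mem_nhds hxi)] with y hy h
      exact absurd hy h
    · exact Eventually.of_forall fun y _ => hxi
  have hiff : ∀ x ∈ S, ∀ y ∈ S, x ∉ interior (closure Ω) → y ∉ interior (closure Ω) :=
    fun x hx y hy => hS.isConnected.isPreconnected.induction₂'
      (fun x y => x ∉ interior (closure Ω) → y ∉ interior (closure Ω))
      (fun x hx => (hloc x hx).and (hloc' x hx))
      (fun x y z _ _ _ h1 h2 h => h2 (h1 h)) hx hy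
  by_contra hpi
  have hall : ∀ x ∈ S, x ∈ interior (closure Ω) := fun x hx => by
    by_contra h
    exact hiff x hx p hp h hpi
  have hopen : IsOpen (closure Ω) := by
    rw [← interior_eq_iff_isOpen]
    refine interior_subset.antisymm fun x hx => ?_
    by_cases hxS : x ∈ S
    · exact hall x hxS
    · by_cases hxΩ : x ∈ Ω
      · exact interior_maximal _root_.subset_closure hS.isOpen_domain hxΩ
      · exact absurd hx (hS.notMem_closure hxS hxΩ)
  have huniv : closure Ω = univ :=
    IsClopen.eq_univ ⟨isClosed_closure, hopen⟩ hS.isConnected_domain.nonempty.closure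
  have hbdd := hS.isBounded_domain.closure
  rw [huniv] at hbdd
  exact NormedSpace.unbounded_univ ℝ (Amb m) hbdd

/-- In a flattening chart, the domain is on exactly one side of the hypersurface. -/
lemma IsEnclosingHypersurface.exists_sign (hS : IsEnclosingHypersurface k S Ω)
    {Φ : OpenPartialHomeomorph (Amb m) (Par m × ℝ)} (hΦ : IsFlatteningChart k S Φ) {p : Amb m}
    (hpS : p ∈ S) (hp : p ∈ Φ.source) : ∃ s : ℝ, |s| = 1 ∧ ∀ᶠ x in 𝓝 p,
      (x ∈ Ω → s * (Φ x).2 ≤ 0) ∧ (x ∉ Ω → 0 ≤ s * (Φ x).2) := by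
  obtain ⟨r, hr, hball, hnhds⟩ := exists_ball_subset_target hp
  have key : ∀ s : ℝ, |s| = 1 →
      (∀ x ∈ Φ.source, Φ x ∈ Metric.ball (Φ p) r → 0 < s * (Φ x).2 → x ∉ closure Ω) →
      (∀ x ∈ Φ.source, Φ x ∈ Metric.ball (Φ p) r → 0 < -s * (Φ x).2 → x ∈ Ω) →
      ∀ᶠ x in 𝓝 p, (x ∈ Ω → s * (Φ x).2 ≤ 0) ∧ (x ∉ Ω → 0 ≤ s * (Φ x).2) := by
    intro s hs h1 h2
    filter_upwards [hnhds] with x hx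
    constructor
    · intro hxΩ
      by_contra! h
      exact h1 x hx.1 hx.2 h (_root_.subset_closure hxΩ)
    · intro hxΩ
      by_contra! h
      exact hxΩ (h2 x hx.1 hx.2 (by linarith))
  -- Both sides inside would make `p` interior to the closure of `Ω`; both outside would leave no
  -- points of `Ω` near `p`. Only the mixed cases survive.
  rcases hS.side_subset hΦ hball 1 with h1 | h1 <;>
    rcases hS.side_subset hΦ hball (-1) with h2 | h2
  · exfalso
    refine hS.notMem_interior_closure hpS (mem_interior_iff_mem_nhds.2
      (mem_of_superset hnhds fun x hx => ?_))
    rcases lt_trichotomy (Φ x).2 0 with h | h | h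
    · exact _root_.subset_closure (h2 x hx.1 hx.2 (by linarith))
    · exact hS.subset_closure ((hΦ.mem_iff x hx.1).2 h)
    · exact _root_.subset_closure (h1 x hx.1 hx.2 (by linarith))
  · exact ⟨-1, by simp, key (-1) (by simp) h2 (by simpa using h1)⟩
  · exact ⟨1, by simp, key 1 (by simp) h1 h2⟩
  · exfalso
    obtain ⟨x, hx, hxΩ⟩ := mem_closure_iff_nhds.1 (hS.subset_closure hpS) _ hnhds
    rcases lt_trichotomy (Φ x).2 0 with h | h | h
    · exact h2 x hx.1 hx.2 (by linarith) (_root_.subset_closure hxΩ)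
    · exact hS.notMem_domain ((hΦ.mem_iff x hx.1).2 h) hxΩ
    · exact h1 x hx.1 hx.2 (by linarith) (_root_.subset_closure hxΩ)

/-- The local defining function given by a flattening chart dominates the distance to `S`. -/
lemma IsFlatteningChart.exists_infDist_le {Φ : OpenPartialHomeomorph (Amb m) (Par m × ℝ)}
    (hΦ : IsFlatteningChart 2 S Φ) {p : Amb m} (hpS : p ∈ S) (hp : p ∈ Φ.source) :
    ∃ K : ℝ, 0 ≤ K ∧ ∀ᶠ x in 𝓝 p, Metric.infDist x S ≤ K * |(Φ x).2| := by
  have h0 := (hΦ.mem_iff p hp).1 hpS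
  have hc : ContDiffAt ℝ 1 Φ.symm (Φ p) :=
    ((hΦ.contDiffOn_symm _ (Φ.map_source hp)).contDiffAt
      (Φ.open_target.mem_nhds (Φ.map_source hp))).of_le (by norm_num)
  obtain ⟨K, t, ht, hK⟩ := hc.exists_lipschitzOnWith
  have hΦc := Φ.continuousAt hp
  have hΦc' : Tendsto (fun x => ((Φ x).1, (0 : ℝ))) (𝓝 p) (𝓝 (Φ p)) := by
    have h1 : Continuous fun z : Par m × ℝ => (z.1, (0 : ℝ)) := by fun_prop
    have h2 := (h1.tendsto (Φ p)).comp hΦc.tendsto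
    have hz : Φ p = ((Φ p).1, (0 : ℝ)) := by rw [← h0]
    rw [hz]
    exact h2
  have htgt := Φ.open_target.mem_nhds (Φ.map_source hp)
  refine ⟨K, K.2, ?_⟩
  filter_upwards [Φ.open_source.mem_nhds hp, hΦc ht, hΦc' ht, hΦc' htgt] with x h1 h2 h3 h4
  have hmem : Φ.symm ((Φ x).1, 0) ∈ S := by
    rw [hΦ.mem_iff _ (Φ.map_target h4), Φ.right_inv h4]
  refine (Metric.infDist_le_dist_of_mem hmem).trans ?_
  have h5 := hK.dist_le_mul _ h2 _ h3
  rw [Φ.left_inv h1] at h5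
  refine h5.trans (le_of_eq ?_)
  simp [Prod.dist_eq]

/-- A function that dominates the distance to a hypersurface and vanishes there is regular. -/
lemma IsFlatteningChart.fderiv_ne_zero {Φ : OpenPartialHomeomorph (Amb m) (Par m × ℝ)}
    (hΦ : IsFlatteningChart 2 S Φ) (hcpt : IsCompact S) {p : Amb m} (hpS : p ∈ S)
    (hp : p ∈ Φ.source) {g : Amb m → ℝ} (hg : DifferentiableAt ℝ g p) (hgp : g p = 0)
    (hdist : ∀ x, Metric.infDist x S ≤ |g x|) : fderiv ℝ g p ≠ 0 := by
  intro hzero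
  have h0 := (hΦ.mem_iff p hp).1 hpS
  have htp := Φ.map_source hp
  have hc : ContDiffAt ℝ 1 Φ p := ((hΦ.contDiffOn _ hp).contDiffAt
      (Φ.open_source.mem_nhds hp)).of_le (by norm_num)
  have hc' : ContDiffAt ℝ 1 Φ.symm (Φ p) := ((hΦ.contDiffOn_symm _ htp).contDiffAt
      (Φ.open_target.mem_nhds htp)).of_le (by norm_num)
  obtain ⟨K, t, ht, hK⟩ := hc.exists_lipschitzOnWith
  have hΦp : Φ p = ((Φ p).1, (0 : ℝ)) := by rw [← h0]
  -- Along this transversal curve the distance to `S` is at least `t / K`, yet a vanishing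
  -- derivative of `g` at `p` would make it `o(t)`.
  let γ : ℝ → Amb m := fun t => Φ.symm ((Φ p).1, t)
  have hγ0 : γ 0 = p := by simp only [γ]; rw [← hΦp, Φ.left_inv hp]
  have hγd : DifferentiableAt ℝ γ 0 := by
    refine DifferentiableAt.comp (𝕜 := ℝ) (0 : ℝ) (g := Φ.symm) (f := fun t : ℝ => ((Φ p).1, t)) ?_
      (by fun_prop)
    rw [← hΦp]; exact hc'.differentiableAt one_ne_zero
  have hgγ : HasDerivAt (g ∘ γ) 0 0 := by
    have h1 : HasFDerivAt g (fderiv ℝ g p) (γ 0) := by rw [hγ0]; exact hg.hasFDerivAt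
    have h2 := h1.comp_hasDerivAt (0 : ℝ) hγd.hasDerivAt
    rwa [hzero, _root_.zero_apply] at h2
  obtain ⟨ε, hε, hεt⟩ := Metric.mem_nhds_iff.1 (inter_mem ht (Φ.open_source.mem_nhds hp))
  have hγt : Tendsto γ (𝓝 0) (𝓝 p) := by
    have := hγd.continuousAt.tendsto; rwa [hγ0] at this
  have hlit : ∀ᶠ t in 𝓝 (0 : ℝ), |g (γ t)| ≤ 1 / (2 * (K + 1)) * |t| := by
    have h1 := (hasDerivAt_iff_isLittleO.1 hgγ).def (c := 1 / (2 * (K + 1))) (by positivity)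
    filter_upwards [h1] with t ht
    simpa [hγ0, hgp] using ht
  have htgt : ∀ᶠ t in 𝓝 (0 : ℝ), ((Φ p).1, t) ∈ Φ.target := by
    have h1 : Continuous fun t : ℝ => ((Φ p).1, t) := by fun_prop
    refine h1.continuousAt.eventually_mem (Φ.open_target.mem_nhds ?_)
    rw [← hΦp]; exact htp
  have hev : ∀ᶠ t in 𝓝[>] (0 : ℝ), γ t ∈ Metric.ball p (ε / 2) ∧
      |g (γ t)| ≤ 1 / (2 * (K + 1)) * |t| ∧ ((Φ p).1, t) ∈ Φ.target :=
    nhdsWithin_le_nhds ((hγt.eventually_mem (Metric.ball_mem_nhds p (half_pos hε))).and (hlit.and htgt))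
  obtain ⟨t, ⟨h1, h2, h3⟩, h4⟩ := (hev.and self_mem_nhdsWithin).exists
  have htpos : 0 < t := h4
  -- The nearest point of `S` is no farther from `γ t` than `p` is, so it stays in the ball where
  -- the Lipschitz bound for `Φ` holds.
  obtain ⟨q, hqS, hq⟩ := hcpt.exists_infDist_eq_dist ⟨p, hpS⟩ (γ t)
  have h5 : dist (γ t) q ≤ dist (γ t) p := hq ▸ Metric.infDist_le_dist_of_mem hpS
  rw [Metric.mem_ball] at h1
  have hγmem := hεt (show γ t ∈ Metric.ball p ε by rw [Metric.mem_ball]; linarith)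
  have hqmem := hεt (show q ∈ Metric.ball p ε by
    rw [Metric.mem_ball]
    linarith [dist_triangle q (γ t) p, dist_comm q (γ t)])
  have h6 := hK.dist_le_mul _ hγmem.1 _ hqmem.1
  have h7 : t ≤ dist (Φ (γ t)) (Φ q) := by
    have e1 : (Φ (γ t)).2 = t := by simp only [γ]; rw [Φ.right_inv h3]
    have e2 : (Φ q).2 = 0 := (hΦ.mem_iff q hqmem.2).1 hqS
    rw [Prod.dist_eq, e1, e2]
    refine le_trans ?_ (le_max_right _ _)
    rw [Real.dist_eq, sub_zero]; exact le_abs_self t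
  rw [← hq] at h6
  have hKn : (0 : ℝ) ≤ K := K.2
  have h8 : t ≤ K * (1 / (2 * (K + 1)) * t) := by
    rw [abs_of_pos htpos] at h2
    calc t ≤ K * Metric.infDist (γ t) S := h7.trans h6
      _ ≤ _ := by gcongr; exact (hdist _).trans h2
  have h9 : (K : ℝ) * (1 / (2 * (K + 1)) * t) ≤ t / 2 := by
    have : (K : ℝ) * (1 / (2 * (K + 1)) * t) = K / (K + 1) * (t / 2) := by field_simp
    rw [this]
    have h10 : (K : ℝ) / (K + 1) ≤ 1 := by rw [div_le_one (by positivity)]; linarith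
    nlinarith
  linarith

/-- The requirements `g ≤ -d` inside, `d ≤ g` outside and `g = 0` on `S`, with `d` the distance to
`S`, are convex at each point. Local solutions, namely multiples of the last chart coordinate near
`S` and constants elsewhere, can therefore be glued by a partition of unity. Domination of the
distance then forces regularity on `S`, so no smoothness of `d` is needed. -/
theorem IsEnclosingHypersurface.exists_defining_function (hS : IsEnclosingHypersurface 2 S Ω) :
    ∃ g : Amb m → ℝ, ContDiff ℝ 2 g ∧ HasCompactSupport (fun x => g x - 1) ∧
      (∀ x, g x = 0 ↔ x ∈ S) ∧ (∀ x, g x < 0 ↔ x ∈ Ω) ∧ ∀ x ∈ S, fderiv ℝ g x ≠ 0 := by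
  set d : Amb m → ℝ := fun x => Metric.infDist x S
  have hdc : Continuous d := Metric.continuous_infDist_pt S
  have hd0 : ∀ x, 0 ≤ d x := fun x => Metric.infDist_nonneg
  have hdS : ∀ x, d x = 0 ↔ x ∈ S := fun x =>
    (hS.isCompact.isClosed.mem_iff_infDist_zero hS.isConnected.nonempty).symm
  let t : Amb m → Set ℝ := fun x => {y | (x ∈ Ω → y ≤ -d x) ∧ (x ∉ Ω → d x ≤ y) ∧ (x ∈ S → y = 0)}
  have htc : ∀ x, Convex ℝ (t x) := fun x => by
    intro y hy z hz a b ha hb hab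
    refine ⟨fun h => ?_, fun h => ?_, fun h => ?_⟩
    · have h1 := hy.1 h
      have h2 := hz.1 h
      simp only [smul_eq_mul]
      have : b = 1 - a := by linarith
      subst this
      nlinarith
    · have h1 := hy.2.1 h
      have h2 := hz.2.1 h
      simp only [smul_eq_mul]
      have : b = 1 - a := by linarith
      subst this
      nlinarith
    · rw [hy.2.2 h, hz.2.2 h]; simp
  obtain ⟨g, hgt⟩ := exists_contMDiffMap_forall_mem_convex_of_local (n := 2)
    (modelWithCornersSelf ℝ (Amb m)) htc (fun x₀ => by
      by_cases hxS : x₀ ∈ S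
      · obtain ⟨Φ, hxΦ, hΦ⟩ := hS.isHypersurface x₀ hxS
        obtain ⟨s, hs1, hs⟩ := hS.exists_sign hΦ hxS hxΦ
        obtain ⟨K, hK0, hK⟩ := hΦ.exists_infDist_le hxS hxΦ
        refine ⟨_, inter_mem (inter_mem hs hK) (Φ.open_source.mem_nhds hxΦ),
          fun x => K * (s * (Φ x).2), ?_, ?_⟩
        · rw [contMDiffOn_iff_contDiffOn]
          have h1 : ContDiffOn ℝ 2 (fun x => K * (s * (Φ x).2)) Φ.source :=
            contDiffOn_const.mul (contDiffOn_const.mul hΦ.contDiffOn.snd)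
          exact h1.mono inter_subset_right
        · rintro y ⟨⟨⟨h1, h2⟩, h3⟩, h4⟩
          have h3' : d y ≤ K * |s * (Φ y).2| := by rw [abs_mul, hs1, one_mul]; exact h3
          refine ⟨fun h => ?_, fun h => ?_, fun h => ?_⟩
          · rw [abs_of_nonpos (h1 h)] at h3'; linarith
          · rwa [abs_of_nonneg (h2 h)] at h3'
          · change K * (s * (Φ y).2) = 0
            rw [(hΦ.mem_iff y h4).1 h, mul_zero, mul_zero]
      · have hnear : ∀ᶠ y in 𝓝 x₀, d y < d x₀ + 1 :=
          hdc.continuousAt.eventually_lt_const (by linarith)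
        by_cases hxΩ : x₀ ∈ Ω
        · refine ⟨_, inter_mem hnear (hS.isOpen_domain.mem_nhds hxΩ), fun _ => -(d x₀ + 1),
            contMDiffOn_const, fun y hy => ⟨fun _ => ?_, fun h => absurd hy.2 h,
            fun h => absurd hy.2 (hS.notMem_domain h)⟩⟩
          have : d y < d x₀ + 1 := hy.1
          linarith
        · have hcl := hS.notMem_closure hxS hxΩ
          refine ⟨_, inter_mem hnear (isClosed_closure.isOpen_compl.mem_nhds hcl),
            fun _ => d x₀ + 1,
            contMDiffOn_const, fun y hy => ⟨fun h => absurd (_root_.subset_closure h) hy.2,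
              fun h => ?_, fun h => absurd (hS.subset_closure h) hy.2⟩⟩
          have : d y < d x₀ + 1 := hy.1
          linarith)
  have hgC : ContDiff ℝ 2 g := contMDiff_iff_contDiff.1 g.contMDiff
  have hg0 : ∀ x ∈ S, g x = 0 := fun x hx => (hgt x).2.2 hx
  have hgneg : ∀ x ∈ Ω, g x < 0 := fun x hx => by
    have h1 := (hgt x).1 hx
    have h2 : d x ≠ 0 := fun h => hS.notMem_domain ((hdS x).1 h) hx
    have := lt_of_le_of_ne (hd0 x) h2.symm
    linarith
  have hgpos : ∀ x, x ∉ Ω → x ∉ S → 0 < g x := fun x hx hx' => by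
    have h1 := (hgt x).2.1 hx
    have h2 : d x ≠ 0 := fun h => hx' ((hdS x).1 h)
    have := lt_of_le_of_ne (hd0 x) h2.symm
    linarith
  have hgd : ∀ x, d x ≤ |g x| := fun x => by
    by_cases hx : x ∈ Ω
    · have := (hgt x).1 hx
      linarith [neg_abs_le (g x)]
    · exact ((hgt x).2.1 hx).trans (le_abs_self _)
  obtain ⟨R, hR0, hR⟩ := hS.isBounded_domain.closure.subset_ball_lt 0 (0 : Amb m)
  let χ : ContDiffBump (0 : Amb m) := ⟨R, R + 1, hR0, by linarith⟩
  have hχ1 : ∀ x ∈ closure Ω, χ =ᶠ[𝓝 x] 1 := fun x hx =>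
    χ.eventuallyEq_one_of_mem_ball (hR hx)
  -- Interpolating between `g` and 1 keeps the function positive outside and changes nothing near
  -- the closure of `Ω`.
  let f : Amb m → ℝ := fun x => χ x * g x + (1 - χ x)
  have hfeq : ∀ x ∈ closure Ω, f =ᶠ[𝓝 x] g := fun x hx => by
    filter_upwards [hχ1 x hx] with y hy
    simp [f, hy]
  have hfpos : ∀ x, x ∉ Ω → x ∉ S → 0 < f x := fun x hx hx' => by
    have h1 := hgpos x hx hx'
    have h2 : 0 ≤ χ x := χ.nonneg
    have h3 : χ x ≤ 1 := χ.le_one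
    rcases h2.eq_or_lt with h | h
    · simp [f, ← h]
    · have := mul_pos h h1
      simp only [f]; linarith
  have hf0 : ∀ x ∈ S, f x = 0 := fun x hx => by
    rw [(hfeq x (hS.subset_closure hx)).eq_of_nhds, hg0 x hx]
  have hfneg : ∀ x ∈ Ω, f x < 0 := fun x hx => by
    rw [(hfeq x (_root_.subset_closure hx)).eq_of_nhds]; exact hgneg x hx
  refine ⟨f, ?_, ?_, fun x => ⟨fun h => ?_, hf0 x⟩, fun x => ⟨fun h => ?_, hfneg x⟩,
    fun x hx => ?_⟩
  · have : ContDiff ℝ 2 χ := χ.contDiff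
    exact (this.mul hgC).add (contDiff_const.sub this)
  · have : (fun x => f x - 1) = fun x => χ x * (g x - 1) := by ext x; simp only [f]; ring
    rw [this]
    exact χ.hasCompactSupport.mul_right
  · by_contra hxS
    by_cases hxΩ : x ∈ Ω
    · exact (hfneg x hxΩ).ne h
    · exact (hfpos x hxΩ hxS).ne' h
  · by_contra hxΩ
    by_cases hxS : x ∈ S
    · exact h.ne (hf0 x hxS)
    · exact (hfpos x hxΩ hxS).not_gt h
  · rw [(hfeq x (hS.subset_closure hx)).fderiv_eq]
    obtain ⟨Φ, hxΦ, hΦ⟩ := hS.isHypersurface x hx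
    exact hΦ.fderiv_ne_zero hS.isCompact hx hxΦ ((hgC.differentiable two_ne_zero) x)
      (hg0 x hx) hgd

end DefiningFunction

/-! ### Regular level sets of analytic functions: charts, normals, connectedness. -/

section LevelSet

variable {m : ℕ} {h : Amb m → ℝ} {p : Amb m}

/-- Complete a nonzero functional to linear coordinates. -/
lemma exists_linear_coordinates {l : Amb m →L[ℝ] ℝ} (hl : l ≠ 0) :
    ∃ (π : Amb m →L[ℝ] Par m) (e : Amb m ≃L[ℝ] Par m × ℝ),
      (e : Amb m →L[ℝ] Par m × ℝ) = π.prod l := by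
  let k : Submodule ℝ (Amb m) := LinearMap.ker (l : Amb m →ₗ[ℝ] ℝ)
  have hk : Module.finrank ℝ k = Module.finrank ℝ (Par m) := by
    have h1 := Module.Dual.finrank_ker_add_one_of_ne_zero (K := ℝ)
      (f := (l : Amb m →ₗ[ℝ] ℝ)) (fun h0 => hl (ContinuousLinearMap.coe_injective h0))
    simp only [finrank_euclideanSpace, Fintype.card_fin] at h1 ⊢
    exact Nat.succ_injective h1
  let e₀ : k ≃ₗ[ℝ] Par m := LinearEquiv.ofFinrankEq _ _ hk
  let π : Amb m →L[ℝ] Par m := e₀.toContinuousLinearEquiv.toContinuousLinearMap ∘L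
    k.orthogonalProjectionOnto
  have hinj : Function.Injective (π.prod l : Amb m →ₗ[ℝ] Par m × ℝ) := by
    rw [← LinearMap.ker_eq_bot, LinearMap.ker_eq_bot']
    intro x hx
    have h1 : π x = 0 := congrArg Prod.fst hx
    have h2 : l x = 0 := congrArg Prod.snd hx
    have h3 : k.orthogonalProjectionOnto x = 0 := by simpa [π] using h1
    have h4 : x ∈ k := h2
    rw [Submodule.orthogonalProjectionOnto_eq_zero_iff] at h3
    exact inner_self_eq_zero.1 (h3 x h4)
  let e₁ : Amb m ≃ₗ[ℝ] Par m × ℝ := LinearEquiv.ofInjectiveOfFinrankEq _ hinj (by simp)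
  refine ⟨π, e₁.toContinuousLinearEquiv, ?_⟩
  ext x <;> rfl

lemma hasFDerivAt_levelCoordinates (hh : ContDiff ℝ ω h) {π : Amb m →L[ℝ] Par m}
    {e : Amb m ≃L[ℝ] Par m × ℝ} (he : (e : Amb m →L[ℝ] Par m × ℝ) = π.prod (fderiv ℝ h p)) :
    HasFDerivAt (fun x => (π x, h x)) (e : Amb m →L[ℝ] Par m × ℝ) p :=
  he ▸ π.hasFDerivAt.prodMk ((hh.differentiable (by simp)) p).hasFDerivAt

lemma isHypersurface_zeroSet (hh : ContDiff ℝ ω h) (hreg : ∀ x, h x = 0 → fderiv ℝ h x ≠ 0) :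
    IsHypersurface ω {x | h x = 0} := by
  intro p hp
  obtain ⟨π, e, he⟩ := exists_linear_coordinates (hreg p hp)
  have hF : ContDiff ℝ ω (fun x => (π x, h x)) := π.contDiff.prodMk hh
  have hd := hasFDerivAt_levelCoordinates hh he
  set Φ := hF.contDiffAt.toOpenPartialHomeomorph (fun x => (π x, h x)) hd (by simp)
  have hpΦ : p ∈ Φ.source := hF.contDiffAt.mem_toOpenPartialHomeomorph_source hd (by simp)
  have hsymm : ContDiffAt ℝ ω Φ.symm (π p, h p) := hF.contDiffAt.to_localInverse hd (by simp)
  -- The inverse function theorem yields analyticity of the inverse only near the image of `p`, so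
  -- the chart is restricted to where it holds.
  obtain ⟨u, hu, hu'⟩ := hsymm.contDiffOn le_rfl (by simp)
  let s : Set (Amb m) := (fun x => (π x, h x)) ⁻¹' interior u
  have hs : IsOpen s := isOpen_interior.preimage hF.continuous
  refine ⟨Φ.restrOpen s hs, ⟨hpΦ, mem_interior_iff_mem_nhds.2 hu⟩, ?_, ?_, ?_⟩
  · exact hF.contDiffOn
  · refine hu'.mono fun y hy => ?_
    have h1 : y ∈ Φ.target ∧ Φ.symm y ∈ s := by simpa using hy
    have h2 : Φ (Φ.symm y) ∈ interior u := h1.2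
    rw [Φ.right_inv h1.1] at h2
    exact interior_subset h2
  · intro x _
    rfl

/-- In coordinates that straighten `h`, the curve is a line in the hyperplane. Such curves test
derivatives within the zero set in every tangential direction. -/
lemma exists_curve_zeroSet (hh : ContDiff ℝ ω h) (hp : h p = 0) (hreg : fderiv ℝ h p ≠ 0)
    {v : Amb m} (hv : fderiv ℝ h p v = 0) :
    ∃ γ : ℝ → Amb m, γ 0 = p ∧ HasDerivAt γ v 0 ∧ ∀ᶠ t in 𝓝 0, h (γ t) = 0 := by
  obtain ⟨π, e, he⟩ := exists_linear_coordinates hreg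
  have hF : ContDiff ℝ ω (fun x => (π x, h x)) := π.contDiff.prodMk hh
  have hd := hasFDerivAt_levelCoordinates hh he
  have hsd : HasStrictFDerivAt (fun x => (π x, h x)) (e : Amb m →L[ℝ] Par m × ℝ) p :=
    hF.contDiffAt.hasStrictFDerivAt' hd (by simp)
  set ψ := hsd.localInverse
  have hψ0 : ψ (π p, h p) = p := hsd.localInverse_apply_image
  have hψd : HasFDerivAt ψ (e.symm : Par m × ℝ →L[ℝ] Amb m) (π p, h p) :=
    hsd.to_localInverse.hasFDerivAt
  have hc : HasDerivAt (fun t : ℝ => (π p + t • π v, (0 : ℝ))) (π v, (0 : ℝ)) 0 := by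
    refine HasDerivAt.prodMk ?_ (hasDerivAt_const _ _)
    simpa using ((hasDerivAt_id (0 : ℝ)).smul_const (π v)).const_add (π p)
  have hc0 : (π p + (0 : ℝ) • π v, (0 : ℝ)) = (π p, h p) := by simp [hp]
  refine ⟨fun t => ψ (π p + t • π v, 0), by simp only [hc0, hψ0], ?_, ?_⟩
  · rw [← hc0] at hψd
    have h1 := HasFDerivAt.comp_hasDerivAt (f := fun t : ℝ => (π p + t • π v, (0 : ℝ)))
      (0 : ℝ) hψd hc
    have h2 : (e.symm : Par m × ℝ →L[ℝ] Amb m) (π v, 0) = v := by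
      have h3 : e v = (π v, (0 : ℝ)) := by
        have := congrArg (fun T : Amb m →L[ℝ] Par m × ℝ => T v) he
        simpa [hv] using this
      rw [← h3]; simp
    rwa [h2] at h1
  · have h1 : ∀ᶠ y in 𝓝 (π p, h p), (π (ψ y), h (ψ y)) = y := hsd.eventually_right_inverse
    rw [← hc0] at h1
    filter_upwards [hc.continuousAt.tendsto.eventually h1] with t ht
    exact congrArg Prod.snd ht

lemma apply_tangentProj_dualDirection (l : Amb m →L[ℝ] ℝ) (w : Amb m) :
    l (tangentProj (dualDirection l) w) = 0 := by
  by_cases hl : l = 0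
  · simp [hl]
  simp only [tangentProj, _root_.sub_apply, ContinuousLinearMap.id_apply,
    ContinuousLinearMap.smulRight_apply, innerSL_apply_apply, map_sub, map_smul, smul_eq_mul,
    inner_dualDirection, apply_dualDirection]
  have : ‖l‖ ≠ 0 := norm_ne_zero_iff.2 hl
  field_simp
  ring

lemma norm_tangentProj_le {v : Amb m} (hv : ‖v‖ = 1) : ‖tangentProj v‖ ≤ 2 := by
  refine (norm_sub_le _ _).trans ?_
  rw [ContinuousLinearMap.norm_smulRight_apply, innerSL_apply_norm, hv]
  linarith [ContinuousLinearMap.norm_id_le (𝕜 := ℝ) (E := Amb m)]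

/-- The surface derivative is the tangential part of any ambient derivative. -/
lemma surfaceDeriv_eq {F : Type*} [NormedAddCommGroup F] [NormedSpace ℝ F] (hh : ContDiff ℝ ω h)
    (hp : h p = 0) (hreg : fderiv ℝ h p ≠ 0) {f f₁ : Amb m → F} {D : Amb m →L[ℝ] F}
    (hf : HasFDerivAt f₁ D p) (heq : ∀ x, h x = 0 → f x = f₁ x) :
    surfaceDeriv {x | h x = 0} (unitNormal h) f p = D ∘L tangentProj (unitNormal h p) := by
  -- Derivatives within the zero set are not unique, because nothing is tested in the normal
  -- direction. Whichever one `fderivWithin` selects, it agrees with `D` on velocities of curves in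
  -- the zero set, and the projection produces only such vectors.
  have h1 : HasFDerivWithinAt f₁ (fderivWithin ℝ f {x | h x = 0} p) {x | h x = 0} p := by
    have h0 : fderivWithin ℝ f {x | h x = 0} p = fderivWithin ℝ f₁ {x | h x = 0} p :=
      fderivWithin_congr (fun x hx => heq x hx) (heq p hp)
    rw [h0]
    exact hf.differentiableAt.differentiableWithinAt.hasFDerivWithinAt
  ext w
  simp only [surfaceDeriv, ContinuousLinearMap.comp_apply]
  obtain ⟨γ, hγ0, hγd, hγ⟩ := exists_curve_zeroSet hh hp hreg
    (v := tangentProj (unitNormal h p) w) (apply_tangentProj_dualDirection _ w)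
  rw [← hγ0] at h1 hf
  have h2 := hf.comp_hasDerivAt (0 : ℝ) hγd
  have h3 := h1.comp_hasDerivWithinAt (t := {x | h x = 0}) (s := {t | h (γ t) = 0}) (0 : ℝ)
    (hγd.hasDerivWithinAt) (fun t ht => ht)
  have h4 := (h3.hasDerivAt hγ).unique h2
  rw [hγ0] at h4
  exact h4

/-- Orthogonality holds because `Dh` and 0 are both derivatives of `h` within its zero set, hence
agree on the tangent cone. The sides follow from the positive slope of `h` along its normal. -/
lemma isOuterUnitNormalAt_unitNormal (hh : ContDiff ℝ ω h) (hp : h p = 0)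
    (hreg : fderiv ℝ h p ≠ 0) :
    IsOuterUnitNormalAt {x | h x = 0} {x | h x < 0} p (unitNormal h p) := by
  have hd := ((hh.differentiable (by simp)) p).hasFDerivAt
  have hpos : 0 < fderiv ℝ h p (unitNormal h p) := by
    rw [unitNormal, apply_dualDirection]; exact norm_pos_iff.2 hreg
  have hline : HasDerivAt (fun t : ℝ => h (p + t • unitNormal h p))
      (fderiv ℝ h p (unitNormal h p)) 0 := by
    have h1 : HasDerivAt (fun t : ℝ => p + t • unitNormal h p) (unitNormal h p) 0 := by
      simpa using ((hasDerivAt_id (0 : ℝ)).smul_const (unitNormal h p)).const_add p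
    have h2 : HasFDerivAt h (fderiv ℝ h p) (p + (0 : ℝ) • unitNormal h p) := by simpa using hd
    exact h2.comp_hasDerivAt (0 : ℝ) h1
  have hslope : ∀ᶠ t in 𝓝[≠] (0 : ℝ), 0 < t⁻¹ * h (p + t • unitNormal h p) := by
    have h1 := hline.tendsto_slope_zero.eventually_const_lt hpos
    filter_upwards [h1] with t ht
    simpa [hp] using ht
  obtain ⟨ε, hε, hεt⟩ := Metric.mem_nhdsWithin_iff.1 hslope
  have hsmall : ∀ᶠ t : ℝ in 𝓝[>] 0, 0 < t ∧ t < ε := by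
    filter_upwards [self_mem_nhdsWithin, nhdsWithin_le_nhds (gt_mem_nhds hε)] with t h1 h2
    exact ⟨h1, h2⟩
  refine ⟨norm_dualDirection hreg, fun w hw => ?_, ?_, ?_⟩
  · have h1 : HasFDerivWithinAt h (fderiv ℝ h p) {x | h x = 0} p := hd.hasFDerivWithinAt
    have h2 : HasFDerivWithinAt h (0 : Amb m →L[ℝ] ℝ) {x | h x = 0} p :=
      (hasFDerivWithinAt_const (0 : ℝ) p _).congr (fun x hx => hx) hp
    have h3 := h1.unique_on h2 hw
    rw [real_inner_comm, unitNormal, inner_dualDirection, h3]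
    simp
  · filter_upwards [hsmall] with t ht
    have h1 : 0 < (-t)⁻¹ * h (p + (-t) • unitNormal h p) :=
      hεt ⟨by simpa [abs_of_pos ht.1] using ht.2, by simpa using ht.1.ne'⟩
    have h2 : (-t)⁻¹ < 0 := inv_lt_zero.2 (by linarith [ht.1])
    have h3 := neg_of_mul_pos_right h1 h2.le
    rwa [neg_smul, ← sub_eq_add_neg] at h3
  · filter_upwards [hsmall] with t ht
    have h1 : 0 < t⁻¹ * h (p + t • unitNormal h p) :=
      hεt ⟨by simpa [abs_of_pos ht.1] using ht.2, by simpa using ht.1.ne'⟩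
    have h3 := (mul_pos_iff_of_pos_left (inv_pos.2 ht.1)).1 h1
    intro hcl
    have h4 : p + t • unitNormal h p ∈ {x | h x ≤ 0} :=
      closure_lt_subset_le hh.continuous continuous_const hcl
    exact absurd h4 (not_le.2 h3)

lemma frontier_sublevel (hh : ContDiff ℝ ω h) (hreg : ∀ x, h x = 0 → fderiv ℝ h x ≠ 0) :
    frontier {x | h x < 0} = {x | h x = 0} := by
  refine (frontier_lt_subset_eq hh.continuous continuous_const).antisymm fun p hp => ?_
  have hopen : IsOpen {x | h x < 0} := isOpen_lt hh.continuous continuous_const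
  have hp' : h p = 0 := hp
  rw [frontier, hopen.interior_eq]
  refine ⟨?_, fun h' => (ne_of_lt h') hp'⟩
  have hin := (isOuterUnitNormalAt_unitNormal hh hp' (hreg p hp')).inside
  have ht : Tendsto (fun t : ℝ => p - t • unitNormal h p) (𝓝[>] 0) (𝓝 p) := by
    have hc : Continuous (fun t : ℝ => p - t • unitNormal h p) := by fun_prop
    simpa using (hc.tendsto 0).mono_left nhdsWithin_le_nhds
  exact mem_closure_of_tendsto ht hin

/-- While the step length is at most `1 / (2 L)`, the gradient changes by at most half its size, so
`h` decreases at rate at least `‖Dh‖² / 2`. -/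
lemma le_of_gradient_step {L s : ℝ} (hh : ContDiff ℝ ω h)
    (hL : ∀ x, ‖fderiv ℝ (fderiv ℝ h) x‖ ≤ L) (hL0 : 0 < L) (hs0 : 0 ≤ s) (hs : s * L ≤ 1 / 2)
    (x : Amb m) : h (x - s • (InnerProductSpace.toDual ℝ (Amb m)).symm (fderiv ℝ h x))
      ≤ h x - s / 2 * ‖fderiv ℝ h x‖ ^ 2 := by
  set V := (InnerProductSpace.toDual ℝ (Amb m)).symm (fderiv ℝ h x)
  have hVn : ‖V‖ = ‖fderiv ℝ h x‖ := LinearIsometryEquiv.norm_map _ _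
  have hVa : fderiv ℝ h x V = ‖fderiv ℝ h x‖ ^ 2 := by
    rw [← hVn, ← real_inner_self_eq_norm_sq]
    exact (InnerProductSpace.toDual_symm_apply (𝕜 := ℝ) (y := fderiv ℝ h x) (x := V)).symm
  have hder : ∀ t, HasDerivAt (fun t : ℝ => h (x - t • V)) (-(fderiv ℝ h (x - t • V) V)) t := by
    intro t
    have h1 : HasDerivAt (fun t : ℝ => x - t • V) (-V) t := by
      simpa using ((hasDerivAt_id t).smul_const V).const_sub x
    have h2 := ((hh.differentiable (by simp)) (x - t • V)).hasFDerivAt.comp_hasDerivAt t h1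
    rwa [map_neg] at h2
  have hbd : ∀ t ∈ interior (Icc 0 s), deriv (fun t : ℝ => h (x - t • V)) t
      ≤ -(1 / 2 * ‖fderiv ℝ h x‖ ^ 2) := fun t ht => by
    have ht' : t ∈ Icc 0 s := interior_subset ht
    rw [(hder t).deriv]
    have h1 : ‖fderiv ℝ h (x - t • V) - fderiv ℝ h x‖ ≤ L * ‖x - t • V - x‖ :=
      convex_univ.norm_image_sub_le_of_norm_fderiv_le (𝕜 := ℝ)
        (fun y _ => ((hh.fderiv_right (m := ω) (by simp)).differentiable (by simp)) y)
        (fun y _ => hL y) (mem_univ x) (mem_univ _)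
    have h2 : |(fderiv ℝ h (x - t • V) - fderiv ℝ h x) V| ≤ 1 / 2 * ‖fderiv ℝ h x‖ ^ 2 := by
      refine (ContinuousLinearMap.le_of_opNorm_le _ h1 V).trans ?_
      rw [sub_sub_cancel_left, norm_neg, norm_smul, Real.norm_of_nonneg ht'.1, hVn]
      have h3 : t * L ≤ 1 / 2 := le_trans (mul_le_mul_of_nonneg_right ht'.2 hL0.le) hs
      calc L * (t * ‖fderiv ℝ h x‖) * ‖fderiv ℝ h x‖ = t * L * ‖fderiv ℝ h x‖ ^ 2 := by ring
        _ ≤ _ := by gcongr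
    rw [_root_.sub_apply, abs_le, hVa] at h2
    linarith [h2.1]
  have := (convex_Icc 0 s).image_sub_le_mul_sub_of_deriv_le
    (fun t _ => (hder t).continuousAt.continuousWithinAt)
    (fun t _ => (hder t).differentiableAt.differentiableWithinAt) hbd
    0 ⟨le_rfl, hs0⟩ s ⟨hs0, le_rfl⟩ hs0
  simp only [zero_smul, sub_zero] at this
  linarith

/-- A sublevel set is connected if it is close to a connected one and `h` is regular near its
boundary. -/
lemma isConnected_sublevel {g : Amb m → ℝ} {N : Set (Amb m)} {L s b c η : ℝ}
    (hh : ContDiff ℝ ω h) (hL : ∀ x, ‖fderiv ℝ (fderiv ℝ h) x‖ ≤ L) (hL0 : 0 < L) (hs0 : 0 < s)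
    (hs : s * L ≤ 1 / 2) (hconn : IsConnected {x | g x < 0}) (hη : ∀ x, |h x - g x| ≤ η)
    (hb0 : 0 ≤ b) (hb : ∀ x ∈ N, b ≤ ‖fderiv ℝ h x‖) (hc : ∀ x, x ∉ N → c ≤ |g x|)
    (hηc : η < c) (hηb : η < s / 2 * b ^ 2) : IsConnected {x | h x < 0} := by
  -- One gradient step lowers `h` on `N` by more than the error `η`. So `T` maps `{g < 0}` into `{h
  -- < 0}`, and it maps points with `h < 0 ≤ g` into `{g < 0}`. Segments from `x` to `T x` stay in
  -- `{h < 0}`, so every point can be joined to the connected core `T '' {g < 0}`.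
  let T : Amb m → Amb m := fun x => x - s • (InnerProductSpace.toDual ℝ (Amb m)).symm (fderiv ℝ h x)
  have hTc : Continuous T := by
    have : Continuous (fderiv ℝ h) := hh.continuous_fderiv (by simp)
    fun_prop
  have hTN : ∀ x ∈ N, h (T x) ≤ h x - s / 2 * b ^ 2 := fun x hx => by
    refine (le_of_gradient_step hh hL hL0 hs0.le hs x).trans ?_
    have := hb x hx
    gcongr
  have hTle : ∀ x, h (T x) ≤ h x := fun x => by
    have := le_of_gradient_step hh hL hL0 hs0.le hs x
    have h2 : 0 ≤ s / 2 * ‖fderiv ℝ h x‖ ^ 2 := by positivity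
    exact this.trans (by linarith)
  have ha : ∀ x, g x < 0 → h (T x) < 0 := fun x hx => by
    have h1 := abs_le.1 (hη x)
    by_cases hxN : x ∈ N
    · linarith [hTN x hxN]
    · have h2 := hc x hxN
      rw [abs_of_neg hx] at h2
      linarith [hTle x]
  have hseg : ∀ x, h x < 0 → segment ℝ x (T x) ⊆ {x | h x < 0} := by
    intro x hx y hy
    rw [segment_eq_image'] at hy
    obtain ⟨θ, hθ, rfl⟩ := hy
    have h1 : x + θ • (T x - x) =
        x - (θ * s) • (InnerProductSpace.toDual ℝ (Amb m)).symm (fderiv ℝ h x) := by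
      simp only [T, sub_sub_cancel_left, smul_neg, smul_smul]; abel
    have hθs : θ * s ≤ s := mul_le_of_le_one_left hs0.le hθ.2
    have h2 := le_of_gradient_step hh hL hL0 (mul_nonneg hθ.1 hs0.le)
      ((mul_le_mul_of_nonneg_right hθs hL0.le).trans hs) x
    have h3 : 0 ≤ θ * s / 2 * ‖fderiv ℝ h x‖ ^ 2 := by
      have := mul_nonneg hθ.1 hs0.le
      positivity
    change h (x + θ • (T x - x)) < 0
    rw [h1]
    linarith
  have hcase : ∀ x, h x < 0 → 0 ≤ g x → g (T x) < 0 := fun x hx hgx => by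
    have h1 := abs_le.1 (hη x)
    have h2 := abs_le.1 (hη (T x))
    have hxN : x ∈ N := by
      by_contra hxN
      have h3 := hc x hxN
      rw [abs_of_nonneg hgx] at h3
      linarith
    linarith [hTN x hxN]
  have hsegc : ∀ x y : Amb m, IsPreconnected (segment ℝ x y) := fun x y =>
    (convex_segment x y).isPreconnected
  have hTΩ : IsPreconnected (T '' {x | g x < 0}) := hconn.isPreconnected.image T hTc.continuousOn
  have hTΩs : T '' {x | g x < 0} ⊆ {x | h x < 0} := by
    rintro _ ⟨x, hx, rfl⟩; exact ha x hx
  obtain ⟨x₁, hx₁⟩ := hconn.nonempty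
  refine ⟨⟨T x₁, ha x₁ hx₁⟩, isPreconnected_of_forall (T x₁) fun y hy => ?_⟩
  by_cases hgy : g y < 0
  · refine ⟨T '' {x | g x < 0} ∪ segment ℝ y (T y), union_subset hTΩs (hseg y hy),
      Or.inl ⟨x₁, hx₁, rfl⟩, Or.inr (left_mem_segment ℝ _ _), ?_⟩
    exact hTΩ.union (T y) ⟨y, hgy, rfl⟩ (right_mem_segment ℝ _ _) (hsegc _ _)
  -- From a point with `0 ≤ g y` two steps are needed: the first enters `{g < 0}`, the second
  -- reaches the core.
  · have hTy := hcase y hy (not_lt.1 hgy)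
    have hhTy : h (T y) < 0 := (hTle y).trans_lt hy
    refine ⟨(T '' {x | g x < 0} ∪ segment ℝ (T y) (T (T y))) ∪ segment ℝ y (T y),
      union_subset (union_subset hTΩs (hseg _ hhTy)) (hseg y hy),
      Or.inl (Or.inl ⟨x₁, hx₁, rfl⟩), Or.inr (left_mem_segment ℝ _ _), ?_⟩
    refine IsPreconnected.union (T y) (Or.inr (left_mem_segment ℝ _ _)) (right_mem_segment ℝ _ _)
      ?_ (hsegc _ _)
    exact hTΩ.union (T (T y)) ⟨T y, hTy, rfl⟩ (right_mem_segment ℝ _ _) (hsegc _ _)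

end LevelSet

/-! ### Surface gradients in terms of ambient derivatives. -/

section SurfaceGradient

variable {m : ℕ} {h ρ : Amb m → ℝ} {p : Amb m}

lemma toDual_symm_comp_tangentProj (l : Amb m →L[ℝ] ℝ) (v : Amb m) :
    (InnerProductSpace.toDual ℝ (Amb m)).symm (l ∘L tangentProj v)
      = (InnerProductSpace.toDual ℝ (Amb m)).symm l - l v • v := by
  refine ext_inner_right ℝ fun w => ?_
  rw [InnerProductSpace.toDual_symm_apply, inner_sub_left, InnerProductSpace.toDual_symm_apply,
    real_inner_smul_left]
  simp [tangentProj, mul_comm]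

/-- The ambient field `∇ρ - (∇ρ | ν) ν`. -/
def tangentialGrad (ν : Amb m → Amb m) (ρ : Amb m → ℝ) (q : Amb m) : Amb m :=
  (InnerProductSpace.toDual ℝ (Amb m)).symm (fderiv ℝ ρ q) - fderiv ℝ ρ q (ν q) • ν q

lemma surfaceGrad_eq (hh : ContDiff ℝ ω h) (hp : h p = 0) (hreg : fderiv ℝ h p ≠ 0)
    (hρ : DifferentiableAt ℝ ρ p) :
    surfaceGrad {x | h x = 0} (unitNormal h) ρ p = tangentialGrad (unitNormal h) ρ p := by
  rw [surfaceGrad, surfaceDeriv_eq hh hp hreg hρ.hasFDerivAt (fun _ _ => rfl),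
    toDual_symm_comp_tangentProj, tangentialGrad]

lemma norm_tangentialGrad_le {ν : Amb m → Amb m} (hν : ‖ν p‖ = 1) :
    ‖tangentialGrad ν ρ p‖ ≤ 2 * ‖fderiv ℝ ρ p‖ := by
  refine (norm_sub_le _ _).trans ?_
  rw [LinearIsometryEquiv.norm_map, norm_smul, hν, mul_one, two_mul]
  gcongr
  simpa [hν] using (fderiv ℝ ρ p).le_opNorm (ν p)

lemma exists_hasFDerivAt_tangentialGrad {ν : Amb m → Amb m} (hν : ‖ν p‖ = 1)
    (hνd : DifferentiableAt ℝ ν p) (hρ : ContDiffAt ℝ 2 ρ p) :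
    ∃ D : Amb m →L[ℝ] Amb m, HasFDerivAt (tangentialGrad ν ρ) D p ∧
      ‖D‖ ≤ 2 * ‖fderiv ℝ (fderiv ℝ ρ) p‖ + 2 * (‖fderiv ℝ ρ p‖ * ‖fderiv ℝ ν p‖) := by
  have hρD : HasFDerivAt (fderiv ℝ ρ) (fderiv ℝ (fderiv ℝ ρ) p) p :=
    ((hρ.fderiv_right (m := 1) (by norm_num)).differentiableAt one_ne_zero).hasFDerivAt
  let J : (Amb m →L[ℝ] ℝ) →L[ℝ] Amb m :=
    (InnerProductSpace.toDual ℝ (Amb m)).symm.toContinuousLinearEquiv.toContinuousLinearMap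
  have hJ : ∀ l, ‖J l‖ = ‖l‖ := fun l => (InnerProductSpace.toDual ℝ (Amb m)).symm.norm_map l
  have h1 : HasFDerivAt (fun q => J (fderiv ℝ ρ q)) (J ∘L fderiv ℝ (fderiv ℝ ρ) p) p :=
    J.hasFDerivAt.comp p hρD
  have h2 := (hρD.clm_apply hνd.hasFDerivAt).smul hνd.hasFDerivAt
  refine ⟨_, h1.sub h2, ?_⟩
  have hρν : ‖fderiv ℝ ρ p (ν p)‖ ≤ ‖fderiv ℝ ρ p‖ := by
    simpa [hν] using (fderiv ℝ ρ p).le_opNorm (ν p)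
  have b1 : ‖J ∘L fderiv ℝ (fderiv ℝ ρ) p‖ ≤ ‖fderiv ℝ (fderiv ℝ ρ) p‖ := by
    refine ContinuousLinearMap.opNorm_le_bound _ (norm_nonneg _) fun w => ?_
    rw [ContinuousLinearMap.comp_apply, hJ]
    exact ContinuousLinearMap.le_opNorm _ _
  have b2 : ‖fderiv ℝ ρ p (ν p) • fderiv ℝ ν p‖ ≤ ‖fderiv ℝ ρ p‖ * ‖fderiv ℝ ν p‖ := by
    rw [norm_smul]; gcongr
  have b3 : ‖fderiv ℝ ρ p ∘L fderiv ℝ ν p + (fderiv ℝ (fderiv ℝ ρ) p).flip (ν p)‖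
      ≤ ‖fderiv ℝ ρ p‖ * ‖fderiv ℝ ν p‖ + ‖fderiv ℝ (fderiv ℝ ρ) p‖ := by
    refine (norm_add_le _ _).trans (add_le_add (ContinuousLinearMap.opNorm_comp_le _ _) ?_)
    refine ((fderiv ℝ (fderiv ℝ ρ) p).flip.le_opNorm (ν p)).trans ?_
    rw [hν, mul_one, ContinuousLinearMap.opNorm_flip]
  have b4 : ‖(fderiv ℝ ρ p ∘L fderiv ℝ ν p
      + (fderiv ℝ (fderiv ℝ ρ) p).flip (ν p)).smulRight (ν p)‖
      ≤ ‖fderiv ℝ ρ p‖ * ‖fderiv ℝ ν p‖ + ‖fderiv ℝ (fderiv ℝ ρ) p‖ := by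
    rw [ContinuousLinearMap.norm_smulRight_apply, hν, mul_one]; exact b3
  refine (norm_sub_le _ _).trans ((add_le_add b1 ((norm_add_le _ _).trans
    (add_le_add b2 b4))).trans (le_of_eq ?_))
  ring

/-- On the zero set the surface gradient coincides with the ambient field `tangentialGrad`, so its
surface derivative is the tangential part of an ambient one. The outer factor 2 bounds the
tangential projection; the adjoint preserves the norm. -/
lemma norm_surfaceGrad2_le (hh : ContDiff ℝ ω h) (hreg : ∀ x, h x = 0 → fderiv ℝ h x ≠ 0)
    (hρ : ∀ x, h x = 0 → ContDiffAt ℝ 2 ρ x) (hp : h p = 0) :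
    ‖surfaceGrad2 {x | h x = 0} (unitNormal h) ρ p‖ ≤
      2 * (2 * ‖fderiv ℝ (fderiv ℝ ρ) p‖
        + 2 * (‖fderiv ℝ ρ p‖ * ‖fderiv ℝ (unitNormal h) p‖)) := by
  have hν := norm_dualDirection (hreg p hp)
  obtain ⟨D, hD, hDn⟩ := exists_hasFDerivAt_tangentialGrad (ν := unitNormal h) (ρ := ρ) hν
    ((contDiffAt_unitNormal hh (hreg p hp) (n := 1) (by simp)).differentiableAt one_ne_zero)
    (hρ p hp)
  rw [surfaceGrad2, LinearIsometryEquiv.norm_map, surfaceDeriv_eq hh hp (hreg p hp) hD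
    (fun x hx => surfaceGrad_eq hh hx (hreg x hx) ((hρ x hx).differentiableAt two_ne_zero))]
  refine (ContinuousLinearMap.opNorm_comp_le _ _).trans ?_
  rw [mul_comm]
  gcongr
  exact norm_tangentProj_le hν

lemma supNorm_le {F : Type*} [NormedAddCommGroup F] {S : Set (Amb m)} {f : Amb m → F} {c : ℝ}
    (hf : ∀ p ∈ S, ‖f p‖ ≤ c) : supNorm S f ≤ ENNReal.ofReal c :=
  iSup₂_le fun p hp => by
    rw [← ofReal_norm]; exact ENNReal.ofReal_le_ofReal (hf p hp)

lemma isOfClassOn_of_contDiffAt {k : WithTop ℕ∞} {S : Set (Amb m)}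
    (hρ : ∀ x ∈ S, ContDiffAt ℝ k ρ x) : IsOfClassOn k S ρ := by
  intro Φ hΦ θ hθ
  have hθ' : (θ, (0 : ℝ)) ∈ Φ.target := hθ
  have hmem : Φ.symm (θ, 0) ∈ S := by
    rw [hΦ.mem_iff _ (Φ.map_target hθ'), Φ.right_inv hθ']
  have h1 : ContDiffAt ℝ k Φ.symm (θ, (0 : ℝ)) :=
    (hΦ.contDiffOn_symm _ hθ').contDiffAt (Φ.open_target.mem_nhds hθ')
  have h2 : ContDiffAt ℝ k (fun θ : Par m => (θ, (0 : ℝ))) θ :=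
    contDiffAt_id.prodMk contDiffAt_const
  exact ((hρ _ hmem).comp θ (h1.comp θ h2)).contDiffWithinAt

end SurfaceGradient

/-! ### Injectivity and surjectivity of small perturbations of the identity. -/

section SmallPerturbation

variable {E : Type*} [NormedAddCommGroup E] [NormedSpace ℝ E] {V : E → E} {N : Set E}

lemma norm_sub_le_half_of_fderiv {U : Set E} (hU : Convex ℝ U) (hUN : U ⊆ N)
    (hVd : ∀ x ∈ N, DifferentiableAt ℝ V x) (hV : ∀ x ∈ N, ‖fderiv ℝ V x‖ ≤ 1 / 2) {x y : E}
    (hx : x ∈ U) (hy : y ∈ U) : ‖V y - V x‖ ≤ 1 / 2 * ‖y - x‖ :=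
  hU.norm_image_sub_le_of_norm_fderiv_le (𝕜 := ℝ) (fun z hz => hVd z (hUN hz))
    (fun z hz => hV z (hUN hz)) hx hy

/-- Points with equal images differ by a difference of two values of `V`, hence by less than `r`.
They lie in a common ball inside `N`, on which `V` is a contraction; convexity of `N` itself is not
required. -/
lemma injOn_add_of_small {A : Set E} {r : ℝ} (hr : ∀ x ∈ A, Metric.ball x r ⊆ N)
    (hVd : ∀ x ∈ N, DifferentiableAt ℝ V x) (hV : ∀ x ∈ N, ‖fderiv ℝ V x‖ ≤ 1 / 2)
    (hVr : ∀ x ∈ A, ‖V x‖ < r / 2) : InjOn (fun x => x + V x) A := by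
  intro x hx y hy hxy
  have h1 : y - x = V x - V y := by
    have : x + V x = y + V y := hxy
    rw [sub_eq_sub_iff_add_eq_add, ← this, add_comm]
  have h2 : ‖y - x‖ < r := by
    rw [h1]
    exact (norm_sub_le _ _).trans_lt (by linarith [hVr x hx, hVr y hy])
  have h0 : 0 < r := (norm_nonneg _).trans_lt h2
  have h3 := norm_sub_le_half_of_fderiv (convex_ball x r) (hr x hx) hVd hV
    (mem_ball_iff_norm.2 h2) (Metric.mem_ball_self h0)
  rw [← h1] at h3
  rw [norm_sub_rev x y] at h3
  have h4 : ‖y - x‖ = 0 := le_antisymm (by linarith) (norm_nonneg _)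
  exact (sub_eq_zero.1 (norm_eq_zero.1 h4)).symm

/-- The solution is the Banach fixed point of `x ↦ q - V x` on the closed ball. -/
lemma exists_add_eq_of_small [CompleteSpace E] {q : E} {r : ℝ} (h0 : 0 < r)
    (hr : Metric.closedBall q r ⊆ N)
    (hVd : ∀ x ∈ N, DifferentiableAt ℝ V x) (hV : ∀ x ∈ N, ‖fderiv ℝ V x‖ ≤ 1 / 2)
    (hVr : ∀ x ∈ N, ‖V x‖ ≤ r) : ∃ x ∈ Metric.closedBall q r, x + V x = q := by
  have hmaps : MapsTo (fun x => q - V x) (Metric.closedBall q r) (Metric.closedBall q r) :=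
    fun x hx => by
      rw [mem_closedBall_iff_norm]
      simpa using hVr x (hr hx)
  have hcontr : ContractingWith (1 / 2) (hmaps.restrict (fun x => q - V x) _ _) := by
    refine ⟨by norm_num, LipschitzWith.of_dist_le_mul fun x y => ?_⟩
    have := norm_sub_le_half_of_fderiv (convex_closedBall q r) hr hVd hV x.2 y.2
    rw [Subtype.dist_eq, Subtype.dist_eq, dist_eq_norm, dist_eq_norm]
    simp only [MapsTo.val_restrict_apply, sub_sub_sub_cancel_left]
    rw [norm_sub_rev (x : E)]
    simpa using this
  obtain ⟨x, hx, hfix, -⟩ := hcontr.exists_fixedPoint' Metric.isClosed_closedBall.isComplete hmaps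
    (Metric.mem_closedBall_self h0.le) (edist_ne_top _ _)
  refine ⟨x, hx, ?_⟩
  have : q - V x = x := hfix
  exact (sub_eq_iff_eq_add.1 this).symm

end SmallPerturbation

/-- A continuous injection of a compact set into a Hausdorff space is an embedding, so connectedness
can be pulled back. -/
lemma isConnected_of_injOn_image {X Y : Type*} [TopologicalSpace X] [TopologicalSpace Y]
    [T2Space Y] {f : X → Y} {A : Set X} (hA : IsCompact A) (hf : ContinuousOn f A) (hinj : InjOn f A)
    (hc : IsConnected (f '' A)) : IsConnected A := by
  have : CompactSpace A := isCompact_iff_compactSpace.1 hA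
  have hemb : Topology.IsClosedEmbedding (A.domRestrict f) :=
    (continuousOn_iff_continuous_domRestrict.1 hf).isClosedEmbedding (injOn_iff_injective.1 hinj)
  have h1 : A.domRestrict f '' univ = f '' A := by rw [image_univ, range_domRestrict]
  refine ⟨image_nonempty.1 hc.nonempty, ?_⟩
  rw [isPreconnected_iff_preconnectedSpace]
  refine ⟨?_⟩
  rw [← hemb.isInducing.isPreconnected_image, h1]
  exact hc.isPreconnected

/-! ### Uniform constants for the defining function and its approximations. -/

section Assembly

variable {m : ℕ} {g : Amb m → ℝ}

lemma exists_isApprox (hg : ContDiff ℝ 2 g) (hc : HasCompactSupport (fun x => g x - 1)) {η : ℝ}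
    (hη : 0 < η) : ∃ h : Amb m → ℝ, ContDiff ℝ ω h ∧ IsApprox η g h := by
  obtain ⟨v, hv, happ⟩ := exists_analytic_approx (hg.sub contDiff_const) hc hη
  have e1 : fderiv ℝ (fun x => v x + 1) = fderiv ℝ v := funext fun x => fderiv_add_const 1
  have e2 : fderiv ℝ (fun x => g x - 1) = fderiv ℝ g := funext fun x => fderiv_sub_const 1
  refine ⟨fun x => v x + 1, hv.add contDiff_const, fun x => ?_⟩
  have h1 := happ x
  rw [e2] at h1
  rw [e1]
  have e3 : v x + 1 - g x = v x - (g x - 1) := by ring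
  rw [e3]
  exact h1

lemma exists_global_bounds (hg : ContDiff ℝ 2 g) (hc : HasCompactSupport (fun x => g x - 1)) :
    ∃ M, (∀ x, ‖fderiv ℝ g x‖ ≤ M) ∧ (∀ x, ‖fderiv ℝ (fderiv ℝ g) x‖ ≤ M) ∧
      UniformContinuous (fderiv ℝ (fderiv ℝ g)) := by
  have e2 : fderiv ℝ (fun x => g x - 1) = fderiv ℝ g := funext fun x => fderiv_sub_const 1
  have hD : ContDiff ℝ 1 (fderiv ℝ g) := hg.fderiv_right (by norm_num)
  have hDD : Continuous (fderiv ℝ (fderiv ℝ g)) := hD.continuous_fderiv one_ne_zero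
  have hc1 : HasCompactSupport (fderiv ℝ g) := e2 ▸ hc.fderiv ℝ
  have hc2 : HasCompactSupport (fderiv ℝ (fderiv ℝ g)) := hc1.fderiv ℝ
  obtain ⟨M₁, hM₁⟩ := hD.continuous.bounded_above_of_compact_support hc1
  obtain ⟨M₂, hM₂⟩ := hDD.bounded_above_of_compact_support hc2
  exact ⟨max M₁ M₂, fun x => (hM₁ x).trans (le_max_left _ _),
    fun x => (hM₂ x).trans (le_max_right _ _), hc2.uniformContinuous_of_continuous hDD⟩

/-- Near its zero set, a regular function has gradient bounded below; away from it, the function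
itself is bounded below. -/
lemma exists_regular_thickening {S : Set (Amb m)} (hS : IsCompact S)
    (hg : ContDiff ℝ 2 g) (hc : HasCompactSupport (fun x => g x - 1))
    (hg0 : ∀ x, g x = 0 ↔ x ∈ S) (hreg : ∀ x ∈ S, fderiv ℝ g x ≠ 0) :
    ∃ b > 0, ∃ r > 0, ∃ c > 0, (∀ x ∈ Metric.thickening r S, b ≤ ‖fderiv ℝ g x‖) ∧
      ∀ x, x ∉ Metric.thickening (r / 2) S → c ≤ |g x| := by
  have hDc : Continuous fun x => ‖fderiv ℝ g x‖ := (hg.continuous_fderiv two_ne_zero).norm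
  obtain ⟨b', hb', hbS⟩ := hS.exists_forall_le' hDc.continuousOn (a := 0)
    (fun x hx => norm_pos_iff.2 (hreg x hx))
  obtain ⟨r, hr, hrU⟩ := hS.exists_thickening_subset_open
    (isOpen_lt continuous_const hDc : IsOpen {x | b' / 2 < ‖fderiv ℝ g x‖})
    (fun x hx => by have := hbS x hx; change b' / 2 < ‖fderiv ℝ g x‖; linarith)
  -- Off the support of `g - 1` one has `g = 1`, so the lower bound on `|g|` is only in question on
  -- this compact set.
  have hK : IsCompact (tsupport (fun x => g x - 1) \ Metric.thickening (r / 2) S) :=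
    IsCompact.diff hc Metric.isOpen_thickening
  obtain ⟨c', hc', hcK⟩ := hK.exists_forall_le' hg.continuous.abs.continuousOn (a := 0)
    (fun x hx => abs_pos.2 fun h0 =>
      hx.2 (Metric.self_subset_thickening (half_pos hr) S ((hg0 x).1 h0)))
  refine ⟨b' / 2, by linarith, r, hr, min c' 1, by positivity, fun x hx => (hrU hx).le,
    fun x hx => ?_⟩
  by_cases hxs : x ∈ tsupport (fun x => g x - 1)
  · exact (min_le_left _ _).trans (hcK x ⟨hxs, hx⟩)
  · have h1 : g x - 1 = 0 := image_eq_zero_of_notMem_tsupport (f := fun x => g x - 1) hxs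
    have h2 : g x = 1 := by linarith
    rw [h2, abs_one]
    exact min_le_right _ _

end Assembly

end HypersurfaceApprox

end

/-! ### The main theorem. -/

set_option maxSynthPendingDepth 3 in
open HypersurfaceApprox Set in
theorem mainTheorem6 (m : ℕ) (S Ω : Set (HypersurfaceApprox.Amb m))
    (hS : HypersurfaceApprox.IsEnclosingHypersurface 2 S Ω) (ε : ℝ) (hε : 0 < ε) :
    ∃ (S' Ω' : Set (HypersurfaceApprox.Amb m))
      (ν : HypersurfaceApprox.Amb m → HypersurfaceApprox.Amb m)
      (ρ : HypersurfaceApprox.Amb m → ℝ),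
      HypersurfaceApprox.IsEnclosingHypersurface ω S' Ω' ∧
      (∀ p ∈ S', HypersurfaceApprox.IsOuterUnitNormalAt S' Ω' p (ν p)) ∧
      HypersurfaceApprox.IsOfClassOn 2 S' ρ ∧
      Set.InjOn (fun p => p + ρ p • ν p) S' ∧
      S = {q | ∃ p ∈ S', q = p + ρ p • ν p} ∧
      HypersurfaceApprox.supNorm S' ρ
        + HypersurfaceApprox.supNorm S' (HypersurfaceApprox.surfaceGrad S' ν ρ)
        + HypersurfaceApprox.supNorm S' (HypersurfaceApprox.surfaceGrad2 S' ν ρ)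
        ≤ ENNReal.ofReal ε := by
  obtain ⟨g, hg, hgc, hg0, hgΩ, hgreg⟩ := hS.exists_defining_function
  obtain ⟨M, hM1, hM2, huc⟩ := exists_global_bounds hg hgc
  have hM0 : 0 ≤ M := (norm_nonneg _).trans (hM1 0)
  obtain ⟨b, hb, r, hr, c, hc, hbN, hcN⟩ :=
    exists_regular_thickening hS.isCompact hg hgc hg0 hgreg
  set N := Metric.thickening r S
  have hN : IsOpen N := Metric.isOpen_thickening
  obtain ⟨K, hK, hgraph⟩ := exists_graph_function hg hM1 hM2 huc hb hN hbN
  -- smallness of the graph function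
  set ζ := min (min (1 / (2 * (K + 1))) (r / 8)) (ε / (7 + 4 * K))
  have hζ0 : 0 < ζ := by positivity
  -- This bounds the derivative of the displacement by 1/2, since `‖D(ρ • ν)‖ ≤ ζ K + ζ`.
  have hζK : ζ * (K + 1) ≤ 1 / 2 := by
    have h1 : ζ ≤ 1 / (2 * (K + 1)) := (min_le_left _ _).trans (min_le_left _ _)
    calc ζ * (K + 1) ≤ 1 / (2 * (K + 1)) * (K + 1) := by gcongr
      _ = 1 / 2 := by field_simp
  have hζr : ζ ≤ r / 8 := (min_le_left _ _).trans (min_le_right _ _)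
  -- The three suprema are bounded by `ζ`, `2 ζ` and `4 ζ + 4 ζ K`.
  have hζε : ζ * (7 + 4 * K) ≤ ε := by
    have h1 : ζ ≤ ε / (7 + 4 * K) := min_le_right _ _
    rwa [le_div_iff₀ (by positivity)] at h1
  obtain ⟨η₁, hη₁, hgraph⟩ := hgraph ζ hζ0
  -- the analytic approximation
  set L := M + 1
  set s := 1 / (2 * L)
  have hL0 : 0 < L := by positivity
  have hs0 : 0 < s := by positivity
  have hsL : s * L ≤ 1 / 2 := by
    have : s * L = 1 / 2 := by simp only [s]; field_simp
    exact this.le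
  -- The entries serve, in order, the graph function, the bound `M + 1` on `D²h`, the gradient of
  -- `h` on `N`, the confinement of zeros of `h` near `S`, and the drop of `h` in a gradient step.
  set η := min (min η₁ (min 1 (b / 2))) (min (c / 2) (s / 2 * (b / 2) ^ 2 / 2))
  have hη0 : 0 < η := by positivity
  have hηη₁ : η ≤ η₁ := (min_le_left _ _).trans (min_le_left _ _)
  have hη1 : η ≤ 1 := (min_le_left _ _).trans ((min_le_right _ _).trans (min_le_left _ _))
  have hηb : η ≤ b / 2 := (min_le_left _ _).trans ((min_le_right _ _).trans (min_le_right _ _))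
  have hηc : η < c := by
    have : η ≤ c / 2 := (min_le_right _ _).trans (min_le_left _ _)
    linarith
  have hηs : η < s / 2 * (b / 2) ^ 2 := by
    have h1 : η ≤ s / 2 * (b / 2) ^ 2 / 2 := (min_le_right _ _).trans (min_le_right _ _)
    have h2 : 0 < s / 2 * (b / 2) ^ 2 := by positivity
    linarith
  obtain ⟨h, hh, happ⟩ := exists_isApprox hg hgc hη0
  obtain ⟨ρ, hρ⟩ := hgraph h hh fun x => ⟨(happ x).1.trans hηη₁, (happ x).2.1.trans hηη₁,
    (happ x).2.2.1.trans hηη₁, (happ x).2.2.2.trans hηη₁⟩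
  have hhL : ∀ x, ‖fderiv ℝ (fderiv ℝ h) x‖ ≤ L := fun x => by
    have h1 := norm_le_norm_add_norm_sub (fderiv ℝ (fderiv ℝ g) x) (fderiv ℝ (fderiv ℝ h) x)
    rw [norm_sub_rev] at h1
    linarith [hM2 x, (happ x).2.2.1]
  have hhb : ∀ x ∈ N, b / 2 ≤ ‖fderiv ℝ h x‖ := fun x hx => by
    have h1 := norm_le_norm_add_norm_sub (fderiv ℝ h x) (fderiv ℝ g x)
    linarith [hbN x hx, (happ x).2.1]
  have hNN : Metric.thickening (r / 2) S ⊆ N := Metric.thickening_mono (by linarith) S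
  have hzero : ∀ x, h x = 0 → x ∈ Metric.thickening (r / 2) S := fun x hx => by
    by_contra hxN
    have h1 := hcN x hxN
    have h2 := (happ x).1
    rw [hx, zero_sub, abs_neg] at h2
    linarith
  have hreg : ∀ x, h x = 0 → fderiv ℝ h x ≠ 0 := fun x hx => (hρ x (hNN (hzero x hx))).2.1
  have hΩeq : Ω = {x | g x < 0} := Set.ext fun x => (hgΩ x).symm
  have hconn : IsConnected {x | h x < 0} :=
    isConnected_sublevel hh hhL hL0 hs0 hsL (hΩeq ▸ hS.isConnected_domain) (fun x => (happ x).1)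
      (by positivity) hhb (fun x hx => hcN x fun hx' => hx (hNN hx')) hηc hηs
  have hsub : {x | h x < 0} ⊆ Ω ∪ Metric.thickening (r / 2) S := fun x hx => by
    by_cases hxN : x ∈ Metric.thickening (r / 2) S
    · exact Or.inr hxN
    · left
      have hx' : h x < 0 := hx
      have h1 := hcN x hxN
      have h2 := (abs_le.1 (happ x).1).1
      rw [← hgΩ]
      by_contra! h3
      rw [abs_of_nonneg h3] at h1
      linarith
  have hcpt : IsCompact {x | h x = 0} := by
    refine Metric.isCompact_of_isClosed_isBounded (isClosed_eq hh.continuous continuous_const) ?_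
    exact (hS.isCompact.isBounded.thickening).subset fun x hx => hzero x hx
  -- the normal graph
  have hν1 : ∀ x ∈ N, ‖unitNormal h x‖ = 1 := fun x hx => norm_dualDirection (hρ x hx).2.1
  have hρd : ∀ x ∈ N, DifferentiableAt ℝ ρ x := fun x hx =>
    (hρ x hx).1.differentiableAt two_ne_zero
  have hνd : ∀ x ∈ N, DifferentiableAt ℝ (unitNormal h) x := fun x hx =>
    (contDiffAt_unitNormal hh (hρ x hx).2.1 (n := 1) (by simp)).differentiableAt one_ne_zero
  set V : Amb m → Amb m := fun x => ρ x • unitNormal h x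
  have hVd : ∀ x ∈ N, DifferentiableAt ℝ V x := fun x hx => (hρd x hx).smul (hνd x hx)
  have hVn : ∀ x ∈ N, ‖V x‖ ≤ ζ := fun x hx => by
    rw [norm_smul, hν1 x hx, mul_one]; exact (hρ x hx).2.2.2.2.1
  have hVD : ∀ x ∈ N, ‖fderiv ℝ V x‖ ≤ 1 / 2 := fun x hx => by
    have hVf : HasFDerivAt V _ x := (hρd x hx).hasFDerivAt.smul (hνd x hx).hasFDerivAt
    rw [hVf.fderiv]
    refine (norm_normalShift_fderiv_sub_id_le (hρ x hx).2.2.2.1 (hν1 x hx)).trans ?_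
    obtain ⟨h1, h2, -⟩ := (hρ x hx).2.2.2.2
    calc |ρ x| * K + ‖fderiv ℝ ρ x‖ ≤ ζ * K + ζ := by gcongr
      _ = ζ * (K + 1) := by ring
      _ ≤ 1 / 2 := hζK
  have hinj : InjOn (fun x => x + V x) {x | h x = 0} := by
    refine injOn_add_of_small (r := r / 2) (fun x hx y hy => ?_) hVd hVD fun x hx => ?_
    · obtain ⟨z, hz, hxz⟩ := Metric.mem_thickening_iff.1 (hzero x hx)
      refine Metric.mem_thickening_iff.2 ⟨z, hz, ?_⟩
      linarith [dist_triangle y x z, Metric.mem_ball.1 hy]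
    · exact (hVn x (hNN (hzero x hx))).trans_lt (by linarith)
  have himage : S = {q | ∃ p ∈ {x | h x = 0}, q = p + V p} := by
    refine Set.Subset.antisymm (fun q hq => ?_) ?_
    · have hball : Metric.closedBall q (r / 8) ⊆ N := fun y hy =>
        Metric.mem_thickening_iff.2 ⟨q, hq, (Metric.mem_closedBall.1 hy).trans_lt (by linarith)⟩
      obtain ⟨x, hx, hxq⟩ := exists_add_eq_of_small (by positivity) hball hVd hVD
        fun x hx => (hVn x hx).trans hζr
      refine ⟨x, ?_, hxq.symm⟩
      -- The fixed point is not known in advance to be a zero of `h`. It is one because the equation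
      -- for `ρ` holds on all of `N`: `h x = g (x + V x) = g q = 0`.
      change h x = 0
      rw [← (hρ x (hball hx)).2.2.1]
      exact (hg0 _).2 (by rw [hxq]; exact hq)
    · rintro _ ⟨p, hp, rfl⟩
      rw [← hg0, ← (show h p = 0 from hp)]
      exact (hρ p (hNN (hzero p hp))).2.2.1
  have himage' : (fun x => x + V x) '' {x | h x = 0} = S := by
    rw [himage]
    ext q
    exact ⟨fun ⟨p, hp, hpq⟩ => ⟨p, hp, hpq.symm⟩, fun ⟨p, hp, hpq⟩ => ⟨p, hp, hpq.symm⟩⟩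
  -- Connectedness of the new surface is inherited from `S` through the graph map, which is
  -- injective on the compact zero set.
  have hSconn : IsConnected {x | h x = 0} :=
    isConnected_of_injOn_image hcpt (fun x hx => (continuousAt_id.add
      (hVd x (hNN (hzero x hx))).continuousAt).continuousWithinAt) hinj
      (himage' ▸ hS.isConnected)
  have hρ0 : ∀ x, h x = 0 → ContDiffAt ℝ 2 ρ x := fun x hx => (hρ x (hNN (hzero x hx))).1
  refine ⟨{x | h x = 0}, {x | h x < 0}, unitNormal h, ρ, ?_, ?_, ?_, hinj, himage, ?_⟩
  · exact ⟨isHypersurface_zeroSet hh hreg, hcpt, hSconn,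
      isOpen_lt hh.continuous continuous_const, hconn,
      (hS.isBounded_domain.union hS.isCompact.isBounded.thickening).subset hsub,
      frontier_sublevel hh hreg⟩
  · exact fun p hp => isOuterUnitNormalAt_unitNormal hh hp (hreg p hp)
  · exact isOfClassOn_of_contDiffAt hρ0
  · have b0 : supNorm {x | h x = 0} ρ ≤ ENNReal.ofReal ζ :=
      supNorm_le fun p hp => (hρ p (hNN (hzero p hp))).2.2.2.2.1
    have b1 : supNorm {x | h x = 0} (surfaceGrad {x | h x = 0} (unitNormal h) ρ)
        ≤ ENNReal.ofReal (2 * ζ) := supNorm_le fun p hp => by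
      have hpN := hNN (hzero p hp)
      rw [surfaceGrad_eq hh hp (hreg p hp) (hρd p hpN)]
      refine (norm_tangentialGrad_le (hν1 p hpN)).trans ?_
      gcongr
      exact (hρ p hpN).2.2.2.2.2.1
    have b2 : supNorm {x | h x = 0} (surfaceGrad2 {x | h x = 0} (unitNormal h) ρ)
        ≤ ENNReal.ofReal (2 * (2 * ζ + 2 * (ζ * K))) := supNorm_le fun p hp => by
      have hpN := hNN (hzero p hp)
      refine (norm_surfaceGrad2_le hh hreg hρ0 hp).trans ?_
      obtain ⟨h0, -, h1, h2⟩ := (hρ p hpN).2.2.2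
      gcongr
    refine (add_le_add (add_le_add b0 b1) b2).trans ?_
    rw [← ENNReal.ofReal_add (by positivity) (by positivity),
      ← ENNReal.ofReal_add (by positivity) (by positivity)]
    refine ENNReal.ofReal_le_ofReal (le_trans (le_of_eq ?_) hζε)
    ring
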